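/- Let $\mathcal R$ be a term rewrite system: a finite set of rules $l\to r$ over a signature $\mathcal F$ and an infinite set $\mathcal V$ of variables, with $l\notin\mathcal V$ and $\mathrm{Var}(r)\subseteq\mathrm{Var}(l)$. Let $\mathcal D$ be its set of defined symbols (roots of left-hand sides); the other symbols of $\mathcal F$ are constructors, and a basic term is $f(t_1,\dots,t_n)$ with $f\in\mathcal D$ and all $t_i$ built from constructors and variables. Everything below is claimed in two versions, one for full rewriting and one for innermost rewriting. **Pairs and usable rules.** For each $f\in\mathcal F$ let $f^\sharp$ be a fresh symbol of the same arity; put $f(\vec t)^\sharp=f^\sharp(\vec t)$ and $x^\sharp=x$ for variables $x$. The weak dependency pair of $l\to r\in\mathcal R$ is $l^\sharp\to \mathrm{COM}(u_1^\sharp,\dots,u_n^\sharp)$, where $u_1,\dots,u_n$ are, from left to right, the maximal subterms of $r$ whose root is in $\mathcal D\cup\mathcal V$; for the weak innermost dependency pair, $\mathcal D$ replaces $\mathcal D\cup\mathcal V$. Here $\mathrm{COM}(u)=u$, and $\mathrm{COM}(u_1,\dots,u_n)=c(u_1,\dots,u_n)$ for $n\ne1$, with $c$ a fresh compound symbol.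 Let $\mathcal P$ be the set of weak (innermost) dependency pairs, and let $\mathcal T_b^\sharp=\{t^\sharp: t \text{ basic}\}$. For $\mathcal Q\subseteq\mathcal P$, the usable rules $\mathcal U(\mathcal Q)$ are the rules of $\mathcal R$ whose root $g$ satisfies $f\rhd^* g$ for some $f\in\mathcal F$ occurring in a right-hand side of $\mathcal Q$, where $f\rhd g$ means that some rule with root $f$ has the defined symbol $g$ in its right-hand side. **Graph.** The weak (innermost) dependency graph has node set $\mathcal P$ and an edge from $s\to t$ to $u\to v$ iff $t\sigma\to^* C[u\tau]$ for some context $C$ and substitutions $\sigma,\tau:\mathcal V\to\mathcal T(\mathcal F,\mathcal V)$, where $\to$ is the (innermost) rewrite relation of $\mathcal R$. The nodes of its congruence graph are its strongly connected components; $\mathcal K\neq\mathcal L$ are joined by an edge iff some element of $\mathcal K$ has an edge to some element of $\mathcal L$. A source is a node without incoming edges. **Usable replacement maps.** A replacement map $\mu$ is a set of pairs $(f,i)$ with $i$ an argument position of $f$. For a rewrite system $\mathcal S$ let $\Upsilon^{\mathcal S}(\mu)$ be the set of all $(f,i)$ such that $\mathcal S$ has a rule $l\to C[f(r_1,\dots,r_n)]$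 with $\mathrm{CAP}_\mu^l(r_i)\neq r_i$. Here $\mathrm{CAP}_\mu^s(t)=t$ if $t=s|_p$ for a position $p$ of $s$ that is not $\mu$-replacing; otherwise, if $t=f(t_1,\dots,t_n)$ and $u=f(\mathrm{CAP}_\mu^s(t_1),\dots,\mathrm{CAP}_\mu^s(t_n))$ unifies (variables renamed apart) with no left-hand side of $\mathcal S$, then $\mathrm{CAP}_\mu^s(t)=u$; in all other cases it is a fresh variable. The usable replacement map of $\mathcal S$ is the least fixed point of $\Upsilon^{\mathcal S}$; the innermost usable replacement map is $\Upsilon^{\mathcal S}(\varnothing)$. **Interpretations.** A matrix interpretation of dimension $m\ge1$ interprets every symbol of the extended signature by $f(\vec v_1,\dots,\vec v_n)=F_1\vec v_1+\dots+F_n\vec v_n+\vec f$ over $\mathbb N^m$. On vectors, $\geq$ is componentwise, and $v>w$ iff $v_1>w_1$ and $v\geq w$; $\geq_{\mathcal A}$ and $>_{\mathcal A}$ are the relations on terms obtained by comparing values under all assignments. The value of $t$ with all variables set to $\vec 0$ is $[t]$. It is an RMI if for constructors all matrices $F_i$ are upper triangular with diagonal entries at most $1$. It is $\mu$-monotone if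 each $f$ is strictly $>$-monotone in the arguments $i$ with $(f,i)\in\mu$, and adequate (for $\mu$) if $F_i$ is the unit matrix for every compound symbol $f$ and $(f,i)\in\mu$. It has (basic) degree $d$ if for some constant $c$ we have $[t^\sharp]_i\le c\,|t|^d$ for all basic terms $t$ and all $i$. A $\mu$-complexity pair for $\mathcal K/\mathcal E$ is a pair $(\gtrsim,\succ)$ of relations on terms such that $\gtrsim$ is a $\mu$-monotone preorder, $\succ$ is a strict order, $\gtrsim\cdot\succ\subseteq\succ$ or $\succ\cdot\gtrsim\subseteq\succ$, there is a map $G$ from terms to $\mathbb N$ with $G(s)>G(t)$ whenever $s\succ t$ and $s\to t$ in the (innermost) relative rewrite relation of $\mathcal K/\mathcal E$, compound symbols are $\mu$-monotone with respect to $\succ$, and moreover $\mathcal K\subseteq{\succ}$ and $\mathcal E\subseteq{\gtrsim}$. **Statement.** Suppose that for every path $\bar P=(\mathcal P_1,\dots,\mathcal P_k)$, $k\ge1$, in the congruence graph with $\mathcal P_1$ a source, setting $\mathcal Q=\bigcup_{i=1}^k\mathcal P_i$ and letting $\mu$ be the usable (innermost usable) replacement map of $\mathcal Q\cup\mathcal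 U(\mathcal Q)$: 1. $\mathcal A_{\bar P}$ is a $\mu$-monotone and adequate RMI with $\mathcal U(\mathcal Q)\subseteq{>_{\mathcal A_{\bar P}}}$ that admits a weight gap, in the sense that either the maximum $\Delta(\mathcal A_{\bar P},\mathcal Q)$ of the numbers $\max(([\alpha](r))_1-([\alpha](l))_1,0)$ over all $l\to r\in\mathcal Q$ and all assignments $\alpha$ exists, or at least there is $\Delta\in\mathbb N$ with $[t]_1\le[s]_1+\Delta$ whenever $s$ is reachable from $\mathcal T_b^\sharp$ by (innermost) rewriting with $\mathcal Q\cup\mathcal U(\mathcal Q)$ and $s\to t$ is an (innermost, with respect to $\mathcal Q\cup\mathcal U(\mathcal Q)$) step with a pair of $\mathcal Q$; 2. $\mathcal B_{\bar P}$ is an RMI such that $(\geq_{\mathcal B_{\bar P}},>_{\mathcal B_{\bar P}})$ is a $\mu$-complexity pair for $\mathcal P_k/(\mathcal P_1\cup\dots\cup\mathcal P_{k-1}\cup\mathcal U(\mathcal Q))$. Then the (innermost) runtime complexity of $\mathcal R$, that is, the function mapping $n$ to the maximal length of an (innermost) derivation of $\mathcal R$ from a basic term of size at most $n$, is defined and bounded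 by a polynomial for all sufficiently large $n$. Moreover, if $d$ is such that all $\mathcal A_{\bar P}$ and $\mathcal B_{\bar P}$ have degree $d$ (for instance, the maximum of their degrees), then the polynomial can be chosen of degree at most $d$. -/

import Mathlib

open Relation Filter

universe u v w

namespace RC

/-! ## Terms, rules and rewriting -/

/-- A signature: function symbols with their arities. -/
structure Sig where
  Sym : Type u
  ar : Sym → ℕ

/-- First-order terms over the signature `S` with variables from `V`. -/
inductive Term (S : Sig.{u}) (V : Type v) : Type (max u v)
  | var (x : V) : Term S V
  | app (f : S.Sym) (ts : Fin (S.ar f) → Term S V) : Term S V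

namespace Term

variable {S : Sig.{u}} {V : Type v} {W : Type w}

/-- The number of symbols (variables included) of a term. -/
def size : Term S V → ℕ
  | var _ => 1
  | app _ ts => 1 + ∑ i, (ts i).size

/-- Application of a substitution. -/
def subst (σ : V → Term S W) : Term S V → Term S W
  | var x => σ x
  | app f ts => app f fun i => (ts i).subst σ

/-- `Subterm t s`: the term `t` is a (not necessarily proper) subterm of `s`. -/
inductive Subterm : Term S V → Term S V → Prop
  | refl (t : Term S V) : Subterm t t
  | arg {t : Term S V} (f : S.Sym) (ts : Fin (S.ar f) → Term S V) (i : Fin (S.ar f)) :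
      Subterm t (ts i) → Subterm t (app f ts)

/-- `IsArg t s`: the term `t` is one of the arguments of `s`. -/
def IsArg (t s : Term S V) : Prop :=
  ∃ (f : S.Sym) (ts : Fin (S.ar f) → Term S V) (i : Fin (S.ar f)), s = app f ts ∧ t = ts i

/-- The variables occurring in a term. -/
def vars (t : Term S V) : Set V := {x | Subterm (var x) t}

/-- The function symbols occurring in a term. -/
def funs (t : Term S V) : Set S.Sym := {f | ∃ ts, Subterm (app f ts) t}

end Term

open Term

/-- A pair `lhs → rhs` of terms. -/
structure Rule (S : Sig.{u}) (V : Type v) where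
  lhs : Term S V
  rhs : Term S V

/-- Term rewrite systems: finite sets of rules `l → r` with `l` not a variable and
`Var(r) ⊆ Var(l)`. -/
structure IsTRS {S : Sig.{u}} {V : Type v} (R : Set (Rule S V)) : Prop where
  finite : R.Finite
  lhs_ne_var : ∀ ρ ∈ R, ∀ x, ρ.lhs ≠ var x
  vars_subset : ∀ ρ ∈ R, ρ.rhs.vars ⊆ ρ.lhs.vars

section Rewriting

variable {S : Sig.{u}} {V : Type v}

/-- One rewrite step with a rule of `R`, at any position, such that all arguments of the
contracted redex satisfy `ok`. -/
inductive Step (ok : Term S V → Prop) (R : Set (Rule S V)) : Term S V → Term S V → Prop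
  | root (ρ : Rule S V) (hρ : ρ ∈ R) (σ : V → Term S V)
      (hok : ∀ u, IsArg u (ρ.lhs.subst σ) → ok u) :
      Step ok R (ρ.lhs.subst σ) (ρ.rhs.subst σ)
  | arg (f : S.Sym) (ts : Fin (S.ar f) → Term S V) (i : Fin (S.ar f)) (t : Term S V) :
      Step ok R (ts i) t → Step ok R (app f ts) (app f (Function.update ts i t))

/-- Normal forms of `R`. -/
def NF (R : Set (Rule S V)) (t : Term S V) : Prop := ∀ u, ¬ Step (fun _ => True) R t u

/-- The two kinds of rewriting that are treated in parallel. -/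
inductive Strategy
  | full
  | innermost

/-- For `full`, the rewrite relation of `R`; for `innermost`, the restricted rewrite relation of
`R`, in which all arguments of the redex are normal forms of `N`. -/
def Strategy.step : Strategy → Set (Rule S V) → Set (Rule S V) → Term S V → Term S V → Prop
  | .full, _, R => Step (fun _ => True) R
  | .innermost, N, R => Step (NF N) R

/-- The (innermost) rewrite relation of `R`. -/
def Strategy.rew (st : Strategy) (R : Set (Rule S V)) : Term S V → Term S V → Prop :=
  st.step R R

/-- The (innermost) relative rewrite relation of `P` modulo `E`. -/
def Strategy.relRew (st : Strategy) (P E : Set (Rule S V)) : Term S V → Term S V → Prop :=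
  Comp (Comp (ReflTransGen (st.step (P ∪ E) E)) (st.step (P ∪ E) P))
    (ReflTransGen (st.step (P ∪ E) E))

/-- Exactly `n` steps of a relation. -/
def iter {α : Type w} (r : α → α → Prop) : ℕ → α → α → Prop
  | 0 => Eq
  | n + 1 => Comp r (iter r n)

/-- Derivation height: the supremum of the lengths of derivations from `s`. It is `⊤` if these are
unbounded, so a finite bound on it includes the claim that the height is defined. -/
noncomputable def dheight {α : Type w} (r : α → α → Prop) (s : α) : ℕ∞ :=
  ⨆ (n : ℕ) (_ : ∃ t, iter r n s t), (n : ℕ∞)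

/-- The complexity function of the relation `r` on the set `T` of terms. -/
noncomputable def comp (r : Term S V → Term S V → Prop) (T : Set (Term S V)) (n : ℕ) : ℕ∞ :=
  ⨆ (t : Term S V) (_ : t ∈ T ∧ t.size ≤ n), dheight r t

/-- The defined symbols of `R`; all other symbols are constructors. -/
def Defined (R : Set (Rule S V)) : Set S.Sym := {f | ∃ ρ ∈ R, ∃ ls, ρ.lhs = app f ls}

/-- Basic terms: a defined symbol applied to constructor terms. -/
def basicTerms (R : Set (Rule S V)) : Set (Term S V) :=
  {t | ∃ f ∈ Defined R, ∃ ts, t = app f ts ∧ ∀ i, ∀ g ∈ (ts i).funs, g ∉ Defined R}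

/-- The (innermost) runtime complexity function. -/
noncomputable def rc (st : Strategy) (R : Set (Rule S V)) : ℕ → ℕ∞ :=
  comp (st.rew R) (basicTerms R)

end Rewriting

/-- Eventually bounded by a polynomial. -/
def PolyBounded (g : ℕ → ℕ∞) : Prop :=
  ∃ p : Polynomial ℕ, ∀ᶠ n in atTop, g n ≤ ((p.eval n : ℕ) : ℕ∞)

/-- Eventually bounded by a polynomial of degree at most `d`. -/
def PolyBoundedDeg (g : ℕ → ℕ∞) (d : ℕ) : Prop :=
  ∃ p : Polynomial ℕ, p.natDegree ≤ d ∧ ∀ᶠ n in atTop, g n ≤ ((p.eval n : ℕ) : ℕ∞)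

/-! ## Replacement maps -/

/-- A replacement map selects argument positions of every function symbol. -/
abbrev ReplMap (S : Sig.{u}) : Type u := (f : S.Sym) → Set (Fin (S.ar f))

section Usable

variable {S : Sig.{u}} {V : Type v}

/-- `NonRepl μ s t`: the term `t` is the subterm of `s` at some position of `s` that is not
`μ`-replacing. -/
inductive NonRepl (μ : ReplMap S) : Term S V → Term S V → Prop
  | here {t : Term S V} (f : S.Sym) (ts : Fin (S.ar f) → Term S V) (i : Fin (S.ar f)) :
      i ∉ μ f → Subterm t (ts i) → NonRepl μ (app f ts) t
  | inside {t : Term S V} (f : S.Sym) (ts : Fin (S.ar f) → Term S V) (i : Fin (S.ar f)) :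
      NonRepl μ (ts i) t → NonRepl μ (app f ts) t

/-- The terms `u` and `l` are unifiable after renaming their variables apart. -/
def Unifiable {W : Type w} (u : Term S W) (l : Term S V) : Prop :=
  ∃ (σ : W → Term S V) (τ : V → Term S V), u.subst σ = l.subst τ

open scoped Classical in
/-- `cap R μ s t p` is the cap of `t` relative to `s`. Old variables are tagged by `Sum.inl`; a
fresh variable is tagged by `Sum.inr` and named after the position at which it is put (the
argument `p` accumulates that position), so that all fresh variables are distinct. -/
noncomputable def cap (R : Set (Rule S V)) (μ : ReplMap S) (s : Term S V) :
    Term S V → List ℕ → Term S (V ⊕ List ℕ)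
  | var x, p => if NonRepl μ s (var x) then var (Sum.inl x) else var (Sum.inr p)
  | app f ts, p =>
    if NonRepl μ s (app f ts) then (app f ts).subst (fun x => var (Sum.inl x))
    else if ∃ ρ ∈ R, Unifiable (app f fun i => cap R μ s (ts i) (p ++ [(i : ℕ)])) ρ.lhs then
      var (Sum.inr p)
    else app f fun i => cap R μ s (ts i) (p ++ [(i : ℕ)])

/-- The cap of `t` relative to `s` is `t` itself. -/
def CapFix (R : Set (Rule S V)) (μ : ReplMap S) (s t : Term S V) (p : List ℕ) : Prop :=
  cap R μ s t p = t.subst (fun x => var (Sum.inl x))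

/-- The operator on replacement maps whose least fixed point is the usable replacement map:
`(f, i)` is put in if `R` has a rule `l → C[f(r₁, …, rₙ)]` such that the cap of `rᵢ` relative to
`l` differs from `rᵢ`. -/
def upsilon (R : Set (Rule S V)) (μ : ReplMap S) : ReplMap S := fun f =>
  {i | ∃ ρ ∈ R, ∃ rs : Fin (S.ar f) → Term S V,
    Subterm (app f rs) ρ.rhs ∧ ¬ CapFix R μ ρ.lhs (rs i) []}

theorem NonRepl.anti {μ ν : ReplMap S} (h : μ ≤ ν) {s t : Term S V} (hs : NonRepl ν s t) :
    NonRepl μ s t := by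
  induction hs with
  | here f ts i hi ht => exact .here f ts i (fun hm => hi (h f hm)) ht
  | inside f ts i _ ih => exact .inside f ts i ih

open scoped Classical in
theorem CapFix.anti {R : Set (Rule S V)} {μ ν : ReplMap S} (h : μ ≤ ν) {s : Term S V} :
    ∀ (t : Term S V) (p : List ℕ), CapFix R ν s t p → CapFix R μ s t p := by
  intro t
  induction t with
  | var x =>
    intro p hp
    unfold CapFix cap at hp ⊢
    by_cases hn : NonRepl ν s (var x)
    · rw [if_pos (hn.anti h)]; rfl
    · rw [if_neg hn] at hp
      simp [Term.subst] at hp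
  | app f ts ih =>
    intro p hp
    by_cases hm : NonRepl μ s (app f ts)
    · unfold CapFix cap
      rw [if_pos hm]
    · have hn : ¬ NonRepl ν s (app f ts) := fun hn => hm (hn.anti h)
      unfold CapFix cap at hp
      rw [if_neg hn] at hp
      by_cases hu : ∃ ρ ∈ R,
          Unifiable (app f fun i => cap R ν s (ts i) (p ++ [(i : ℕ)])) ρ.lhs
      · rw [if_pos hu] at hp
        simp [Term.subst] at hp
      · rw [if_neg hu] at hp
        have hν : ∀ i, CapFix R ν s (ts i) (p ++ [(i : ℕ)]) := by
          simp only [Term.subst, app.injEq, heq_eq_eq, true_and] at hp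
          exact fun i => congrFun hp i
        have heq : (fun i => cap R μ s (ts i) (p ++ [(i : ℕ)])) =
            fun i => cap R ν s (ts i) (p ++ [(i : ℕ)]) :=
          funext fun i => (ih i _ (hν i)).trans (hν i).symm
        unfold CapFix cap
        rw [if_neg hm, heq, if_neg hu]
        exact hp

theorem upsilon_mono (R : Set (Rule S V)) : Monotone (upsilon R) := by
  rintro μ ν h f i ⟨ρ, hρ, rs, hs, hc⟩
  exact ⟨ρ, hρ, rs, hs, fun hc' => hc (CapFix.anti h _ _ hc')⟩

/-- The usable replacement map (least fixed point of `upsilon R`), respectively the innermost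
usable replacement map (`upsilon R` applied to the empty map). -/
def usableMap : Strategy → Set (Rule S V) → ReplMap S
  | .full, R => OrderHom.lfp ⟨upsilon R, upsilon_mono R⟩
  | .innermost, R => upsilon R ⊥

end Usable

/-! ## Weak (innermost) dependency pairs -/

/-- The symbols of the extended signature: the original symbols `f`, the dependency pair symbols
`f♯`, and compound symbols. There is one compound symbol for every rule and arity, so that the
compound symbol used in the pair of a rule is fresh. -/
inductive ExtSym (S : Sig.{u}) (V : Type v) : Type (max u v)
  | base (f : S.Sym) : ExtSym S V
  | sharp (f : S.Sym) : ExtSym S V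
  | com (n : ℕ) (ρ : Rule S V) : ExtSym S V

/-- Arities in the extended signature. -/
def ExtSym.ar {S : Sig.{u}} {V : Type v} : ExtSym S V → ℕ
  | base f => S.ar f
  | sharp f => S.ar f
  | com n _ => n

/-- The extended signature. -/
@[reducible] def Sig.ext (S : Sig.{u}) (V : Type v) : Sig.{max u v} where
  Sym := ExtSym S V
  ar := ExtSym.ar

section Pairs

variable {S : Sig.{u}} {V : Type v}

/-- Terms over the original signature as terms over the extended one. -/
def emb : Term S V → Term (S.ext V) V
  | var x => var x
  | app f ts => app (S := S.ext V) (ExtSym.base f) fun i => emb (ts i)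

/-- Rules over the original signature as rules over the extended one. -/
def embRule (ρ : Rule S V) : Rule (S.ext V) V := ⟨emb ρ.lhs, emb ρ.rhs⟩

/-- The term `t♯`: the root symbol `f` is replaced by `f♯`, a variable is left as it is. -/
def mark : Term S V → Term (S.ext V) V
  | var x => var x
  | app f ts => app (S := S.ext V) (ExtSym.sharp f) fun i => emb (ts i)

open scoped Classical in
/-- The list `u₁, …, uₙ` with `t = C[u₁, …, uₙ]`, where the `uᵢ` are the maximal subterms of `t`
whose root is a symbol of `D` or, for full rewriting, a variable. -/
noncomputable def cuts (st : Strategy) (D : Set S.Sym) : Term S V → List (Term S V)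
  | var x => match st with
    | .full => [var x]
    | .innermost => []
  | app f ts => if f ∈ D then [app f ts] else (List.ofFn fun i => cuts st D (ts i)).flatten

/-- `u₁` for a one-element list `[u₁]`, and `c(u₁, …, uₙ)` for any other list, where `c` is the
`n`-ary compound symbol that belongs to the rule `ρ`. -/
def compound (ρ : Rule S V) (us : List (Term (S.ext V) V)) : Term (S.ext V) V :=
  match us with
  | [u] => u
  | vs => app (S := S.ext V) (ExtSym.com vs.length ρ) fun i => vs.get i

/-- The weak (innermost) dependency pair of a rule of `R`. -/
noncomputable def weakPair (st : Strategy) (R : Set (Rule S V)) (ρ : Rule S V) :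
    Rule (S.ext V) V :=
  ⟨mark ρ.lhs, compound ρ ((cuts st (Defined R) ρ.rhs).map mark)⟩

/-- The set of weak (innermost) dependency pairs of `R`. -/
noncomputable def weakPairs (st : Strategy) (R : Set (Rule S V)) : Set (Rule (S.ext V) V) :=
  weakPair st R '' R

/-- The marked basic terms `t♯`. -/
def markedBasic (R : Set (Rule S V)) : Set (Term (S.ext V) V) := mark '' basicTerms R

/-- `f` depends on the defined symbol `g`: some rule with root `f` has `g` in its right side. -/
def DependsOn (R : Set (Rule S V)) (f g : S.Sym) : Prop :=
  g ∈ Defined R ∧ ∃ ρ ∈ R, (∃ ls, ρ.lhs = app f ls) ∧ g ∈ ρ.rhs.funs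

/-- The usable rules of a set `P` of pairs: the rules of `R` whose root symbol is reached by the
dependency relation from an original symbol in the right side of a pair of `P`. -/
def usableRules (R : Set (Rule S V)) (P : Set (Rule (S.ext V) V)) : Set (Rule (S.ext V) V) :=
  embRule '' {ρ | ρ ∈ R ∧ ∃ p ∈ P, ∃ f g : S.Sym,
    ExtSym.base f ∈ p.rhs.funs ∧ ReflTransGen (DependsOn R) f g ∧ ∃ ls, ρ.lhs = app g ls}

/-! ## The weak (innermost) dependency graph and its congruence graph -/

/-- The edges of the weak (innermost) dependency graph; its nodes are the weak (innermost)
dependency pairs. -/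
def GraphEdge (st : Strategy) (R : Set (Rule S V)) (p q : Rule (S.ext V) V) : Prop :=
  p ∈ weakPairs st R ∧ q ∈ weakPairs st R ∧
    ∃ (σ τ : V → Term S V) (w : Term (S.ext V) V),
      ReflTransGen (st.rew (embRule '' R)) (p.rhs.subst fun x => emb (σ x)) w ∧
        Subterm (q.lhs.subst fun x => emb (τ x)) w

/-- The strongly connected components, which are the nodes of the congruence graph. -/
def IsSCC (st : Strategy) (R : Set (Rule S V)) (K : Set (Rule (S.ext V) V)) : Prop :=
  ∃ p ∈ weakPairs st R, K = {q | q ∈ weakPairs st R ∧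
    ReflTransGen (GraphEdge st R) p q ∧ ReflTransGen (GraphEdge st R) q p}

/-- The edges of the congruence graph, which join different nodes. -/
def CongEdge (st : Strategy) (R : Set (Rule S V)) (K L : Set (Rule (S.ext V) V)) : Prop :=
  K ≠ L ∧ ∃ p ∈ K, ∃ q ∈ L, GraphEdge st R p q

/-- The source nodes of the congruence graph. -/
def IsSource (st : Strategy) (R : Set (Rule S V)) (K : Set (Rule (S.ext V) V)) : Prop :=
  IsSCC st R K ∧ ∀ L, IsSCC st R L → ¬ CongEdge st R L K

/-- The nonempty paths in the congruence graph that start in a source node. -/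
def IsSourcePath (st : Strategy) (R : Set (Rule S V)) (Ps : List (Set (Rule (S.ext V) V))) : Prop :=
  (∀ K ∈ Ps, IsSCC st R K) ∧ (∃ K, Ps.head? = some K ∧ IsSource st R K) ∧
    Ps.IsChain (CongEdge st R)

/-- The union of the sets in a list. -/
def unionList {α : Type w} (Ps : List (Set α)) : Set α := {p | ∃ K ∈ Ps, p ∈ K}

end Pairs

/-! ## Matrix interpretations -/

/-- A matrix interpretation of dimension `dim + 1` (so that vectors have a first component, with
index `0`): `f(v₁, …, vₙ) = F₁ v₁ + ⋯ + Fₙ vₙ + f₀` over the natural numbers. -/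
structure MatInt (S : Sig.{u}) where
  dim : ℕ
  mat : (f : S.Sym) → Fin (S.ar f) → Matrix (Fin (dim + 1)) (Fin (dim + 1)) ℕ
  vec : S.Sym → Fin (dim + 1) → ℕ

/-- The strict order on vectors: strict in the first component, weak in all components. -/
def VGt {d : ℕ} (v w : Fin (d + 1) → ℕ) : Prop := w 0 < v 0 ∧ w ≤ v

/-- Upper triangular complexity matrices. -/
def IsUpperTriComplexity {d : ℕ} (M : Matrix (Fin d) (Fin d) ℕ) : Prop :=
  (∀ j k, k < j → M j k = 0) ∧ ∀ j, M j j ≤ 1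

namespace MatInt

variable {S : Sig.{u}} {V : Type v} (A : MatInt S)

/-- The interpretation of a function symbol. -/
def interp (f : S.Sym) (vs : Fin (S.ar f) → Fin (A.dim + 1) → ℕ) : Fin (A.dim + 1) → ℕ :=
  ∑ i, (A.mat f i).mulVec (vs i) + A.vec f

/-- Evaluation of a term under an assignment. -/
def eval (α : V → Fin (A.dim + 1) → ℕ) : Term S V → Fin (A.dim + 1) → ℕ
  | .var x => α x
  | .app f ts => A.interp f fun i => eval α (ts i)

/-- Evaluation under the assignment that maps all variables to the zero vector. -/
def eval₀ (t : Term S V) : Fin (A.dim + 1) → ℕ := A.eval (fun _ => 0) t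

/-- The strict relation on terms induced by the interpretation. -/
def Gt (s t : Term S V) : Prop := ∀ α, VGt (A.eval α s) (A.eval α t)

/-- The weak relation on terms induced by the interpretation. -/
def Ge (s t : Term S V) : Prop := ∀ α, A.eval α t ≤ A.eval α s

/-- The interpretation is strictly monotone in all arguments selected by `μ`. -/
def MuMonotone (μ : ReplMap S) : Prop :=
  ∀ f, ∀ i ∈ μ f, ∀ (vs : Fin (S.ar f) → Fin (A.dim + 1) → ℕ) (v : Fin (A.dim + 1) → ℕ),
    VGt (vs i) v → VGt (A.interp f vs) (A.interp f (Function.update vs i v))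

/-- The interpretation is compatible with a set of rules. -/
def Compatible (R : Set (Rule S V)) : Prop := ∀ ρ ∈ R, A.Gt ρ.lhs ρ.rhs

/-- The differences (truncated at zero) whose maximum is the weight gap of a set of pairs. -/
def gapSet (Q : Set (Rule S V)) : Set ℕ :=
  {m | ∃ ρ ∈ Q, ∃ α, m = A.eval α ρ.rhs 0 - A.eval α ρ.lhs 0}

/-- `Δ` is a weight gap of `A` for the relative system `Q/E` on the set `T`. -/
def IsWeightGap (st : Strategy) (Q E : Set (Rule S V)) (T : Set (Term S V)) (Δ : ℕ) : Prop :=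
  ∀ t₀ ∈ T, ∀ s t, ReflTransGen (st.rew (Q ∪ E)) t₀ s → st.step (Q ∪ E) Q s t →
    A.eval₀ t 0 ≤ A.eval₀ s 0 + Δ

end MatInt

section ExtInterpretations

variable {S : Sig.{u}} {V : Type v}

/-- Restricted matrix interpretations: constructor symbols of `R` are interpreted by means of
upper triangular complexity matrices only. -/
def IsRMI (R : Set (Rule S V)) (A : MatInt (S.ext V)) : Prop :=
  ∀ f : S.Sym, f ∉ Defined R → ∀ i, IsUpperTriComplexity (A.mat (ExtSym.base f) i)

/-- Adequacy: compound symbols are interpreted strongly linearly on `μ`, that is, with the unit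
matrix at all arguments selected by `μ`. -/
def Adequate (μ : ReplMap (S.ext V)) (A : MatInt (S.ext V)) : Prop :=
  ∀ (n : ℕ) (ρ : Rule S V), ∀ i ∈ μ (ExtSym.com n ρ), A.mat (ExtSym.com n ρ) i = 1

/-- `A` has basic degree `d`: all components of the value of a (marked) basic term `t` are at most
`c * |t| ^ d`, for a constant `c`. -/
def HasBasicDegree (R : Set (Rule S V)) (A : MatInt (S.ext V)) (d : ℕ) : Prop :=
  ∃ c : ℕ, ∀ t ∈ basicTerms R, ∀ i, A.eval₀ (mark t) i ≤ c * t.size ^ d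

/-- A relation on terms is monotone in the arguments of `f` that are selected by `I`. -/
def MonoOn {S : Sig.{u}} {V : Type v} (r : Term S V → Term S V → Prop) (f : S.Sym)
    (I : Set (Fin (S.ar f))) : Prop :=
  ∀ i ∈ I, ∀ (ts : Fin (S.ar f) → Term S V) (t : Term S V),
    r (ts i) t → r (app f ts) (app f (Function.update ts i t))

/-- The pair `(ge, gt)` is a `μ`-complexity pair for the relative system `P/E`, orienting `P`
strictly and `E` weakly. -/
structure IsComplexityPair (st : Strategy) (μ : ReplMap (S.ext V)) (P E : Set (Rule (S.ext V) V))
    (ge gt : Term (S.ext V) V → Term (S.ext V) V → Prop) : Prop where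
  ge_refl : ∀ s, ge s s
  ge_trans : ∀ s t u, ge s t → ge t u → ge s u
  ge_mono : ∀ f, MonoOn ge f (μ f)
  gt_irrefl : ∀ s, ¬ gt s s
  gt_trans : ∀ s t u, gt s t → gt t u → gt s u
  compat : (∀ s t u, ge s t → gt t u → gt s u) ∨ (∀ s t u, gt s t → ge t u → gt s u)
  collapsible : ∃ G : Term (S.ext V) V → ℕ, ∀ s t, st.relRew P E s t → gt s t → G t < G s
  compound_mono : ∀ (n : ℕ) (ρ : Rule S V), MonoOn gt (ExtSym.com n ρ) (μ (ExtSym.com n ρ))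
  strict : ∀ ρ ∈ P, gt ρ.lhs ρ.rhs
  weak : ∀ ρ ∈ E, ge ρ.lhs ρ.rhs

end ExtInterpretations

end RC

open RC

/-! Below a root step with `l → r`, constructors above the cut-out subterms of `r` never become
redexes. All further steps therefore take place inside instances of those subterms, or inside
instances of variables, which are normal forms in the innermost case. A derivation from a basic term
`s` thus becomes a tree of threads: pairs imitate the root steps of marked terms, and usable rules
imitate the steps below marked roots and in variable instances. Consecutive pairs of a thread are
joined by an edge of the dependency graph. Once a source path leading to the first component is
chosen (`exists_isSourcePath`), every step has a history, which is a source path. A path never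
repeats a component, so there are finitely many histories.

For a source path `E`, keep only the steps whose history is a prefix of `E`. What remains is a
derivation from `s♯` with the pairs `Q` of `E` and their usable rules. Let `a E` and `b E` count the
pair steps and the rule steps with history exactly `E`. The former use the last component, so they
decrease `B E` strictly while all other steps decrease it weakly: `a E ≤ [s♯]` in `B E`
(`Deriv.strict_le`). Rule steps decrease `A E`, and each pair step raises it by at most `Δ E`: `b E
≤ [s♯] + Δ E * ∑ a` in `A E` (`Deriv.rule_le`). The length of the derivation is at most `∑ (a E + b
E)`, which is linear in the values of `s♯`. The bookkeeping is `Simulates`, its construction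
`simulates_basic`, the resulting bound `exists_height_bound`.

Monotonicity is available only at replacing positions. It suffices because subterms at all other
positions remain normal forms throughout (`NonReplNF.step`), so no step happens there.

A common degree `d` turns the linear bound into a polynomial of degree `d` at once. Without it,
triangular matrices give polynomial growth over finitely many symbols (`IsRMI.basic_bound`). As the
signature may be infinite, foreign subterms are first replaced by variables without changing the
length of the derivation (`exists_basic_over`). -/

namespace RC

open Term

/-! ### Terms, subterms and substitutions -/

section TermBasics

variable {S : Sig.{u}} {V : Type v} {W : Type w}

theorem Term.Subterm.trans {a b c : Term S V} (h : Subterm a b) (h' : Subterm b c) :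
    Subterm a c := by
  induction h' with
  | refl => exact h
  | arg f ts i _ ih => exact .arg f ts i ih

theorem Term.Subterm.subst {a b : Term S V} (h : Subterm a b) (σ : V → Term S W) :
    Subterm (a.subst σ) (b.subst σ) := by
  induction h with
  | refl => exact .refl _
  | arg f ts i _ ih => exact .arg f (fun i => (ts i).subst σ) i ih

theorem Term.subterm_app {a : Term S V} {f : S.Sym} {ts : Fin (S.ar f) → Term S V}
    (h : Subterm a (app f ts)) : a = app f ts ∨ ∃ i, Subterm a (ts i) := by
  cases h with
  | refl => exact .inl rfl
  | arg _ _ i h => exact .inr ⟨i, h⟩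

theorem Term.subterm_var {a : Term S V} {x : V} (h : Subterm a (var x)) : a = var x := by
  cases h; rfl

theorem Term.mem_funs_app {g f : S.Sym} {ts : Fin (S.ar f) → Term S V} :
    g ∈ (app f ts).funs ↔ g = f ∨ ∃ i, g ∈ (ts i).funs := by
  constructor
  · rintro ⟨us, h⟩
    rcases subterm_app h with h | ⟨i, h⟩
    · cases h; exact .inl rfl
    · exact .inr ⟨i, us, h⟩
  · rintro (rfl | ⟨i, us, h⟩)
    · exact ⟨ts, .refl _⟩
    · exact ⟨us, .arg _ _ i h⟩

theorem Term.not_mem_funs_var {g : S.Sym} {x : V} : g ∉ (var x : Term S V).funs := by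
  rintro ⟨us, h⟩
  cases h

theorem Term.mem_vars_app {x : V} {f : S.Sym} {ts : Fin (S.ar f) → Term S V} :
    x ∈ (app f ts).vars ↔ ∃ i, x ∈ (ts i).vars := by
  constructor
  · intro h
    rcases subterm_app h with h | ⟨i, h⟩
    · cases h
    · exact ⟨i, h⟩
  · rintro ⟨i, h⟩
    exact .arg _ _ i h

theorem Term.mem_vars_var {x y : V} : x ∈ (var y : Term S V).vars ↔ x = y := by
  constructor
  · intro h
    have := subterm_var h
    cases this; rfl
  · rintro rfl
    exact .refl _

theorem Term.mem_funs_subst {g : S.Sym} {σ : V → Term S W} {t : Term S V} :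
    g ∈ (t.subst σ).funs ↔ g ∈ t.funs ∨ ∃ x ∈ t.vars, g ∈ (σ x).funs := by
  induction t with
  | var x => simp [Term.subst, not_mem_funs_var, mem_vars_var]
  | app f ts ih =>
    simp only [Term.subst, mem_funs_app, mem_vars_app, ih]
    constructor
    · rintro (h | ⟨i, h | ⟨x, hx, h⟩⟩)
      · exact .inl (.inl h)
      · exact .inl (.inr ⟨i, h⟩)
      · exact .inr ⟨x, ⟨i, hx⟩, h⟩
    · rintro ((h | ⟨i, h⟩) | ⟨x, ⟨i, hx⟩, h⟩)
      · exact .inl h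
      · exact .inr ⟨i, .inl h⟩
      · exact .inr ⟨i, .inr ⟨x, hx, h⟩⟩

theorem Term.funs_finite (t : Term S V) : t.funs.Finite := by
  induction t with
  | var x =>
    convert Set.finite_empty
    ext g
    simp [not_mem_funs_var]
  | app f ts ih =>
    have : (app f ts).funs = {f} ∪ ⋃ i, (ts i).funs := by
      ext g
      simp [mem_funs_app]
    rw [this]
    exact (Set.finite_singleton f).union (Set.finite_iUnion ih)

theorem Term.subst_subst {X : Type*} (σ : V → Term S W) (τ : W → Term S X) (t : Term S V) :
    (t.subst σ).subst τ = t.subst fun x => (σ x).subst τ := by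
  induction t with
  | var x => rfl
  | app f ts ih =>
    simp only [Term.subst]
    congr 1
    funext i
    exact ih i

theorem Term.subst_app_update (τ : V → Term S W) (f : S.Sym) (ts : Fin (S.ar f) → Term S V)
    (i : Fin (S.ar f)) (t : Term S V) :
    (app f (Function.update ts i t)).subst τ =
      app f (Function.update (fun i => (ts i).subst τ) i (t.subst τ)) := by
  simp only [Term.subst, app.injEq, heq_eq_eq, true_and]
  funext j
  by_cases hj : j = i
  · subst hj; simp
  · simp [hj]

theorem Term.size_pos (t : Term S V) : 1 ≤ t.size := by
  cases t <;> simp [size]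

/-- Every variable of a proper term lies in one of its arguments. -/
theorem Term.exists_isArg_of_mem_vars {x : V} {l : Term S V} (hx : x ∈ l.vars)
    (hl : ∀ y, l ≠ var y) : ∃ u, IsArg u l ∧ x ∈ u.vars := by
  cases l with
  | var y => exact absurd rfl (hl y)
  | app f ts =>
    obtain ⟨i, hi⟩ := mem_vars_app.1 hx
    exact ⟨ts i, ⟨f, ts, i, rfl, rfl⟩, hi⟩

theorem Term.IsArg.subst {u t : Term S V} (h : IsArg u t) (σ : V → Term S W) :
    IsArg (u.subst σ) (t.subst σ) := by
  obtain ⟨f, ts, i, rfl, rfl⟩ := h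
  exact ⟨f, fun i => (ts i).subst σ, i, rfl, rfl⟩

end TermBasics

/-! ### Rewrite steps and normal forms -/

section StepBasics

variable {S : Sig.{u}} {V : Type v}

theorem Step.mono {ok ok' : Term S V → Prop} {R R' : Set (Rule S V)}
    (h : ∀ t, ok t → ok' t) (hR : R ⊆ R') {s t : Term S V} (hs : Step ok R s t) :
    Step ok' R' s t := by
  induction hs with
  | root ρ hρ σ hok => exact .root ρ (hR hρ) σ fun u hu => h _ (hok u hu)
  | arg f ts i t _ ih => exact .arg f ts i t ih

theorem NF.not_step {ok : Term S V → Prop} {R : Set (Rule S V)} {s t : Term S V} (h : NF R s) :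
    ¬ Step ok R s t := fun hs => h t (hs.mono (fun _ _ => trivial) subset_rfl)

/-- The condition that a strategy imposes on the arguments of a redex. -/
def Strategy.ok : Strategy → Set (Rule S V) → Term S V → Prop
  | .full, _ => fun _ => True
  | .innermost, N => NF N

theorem Strategy.step_eq (st : Strategy) (N R : Set (Rule S V)) :
    st.step N R = Step (st.ok N) R := by
  cases st <;> rfl

theorem Step.exists_of_subterm {ok : Term S V → Prop} {R : Set (Rule S V)} {a a' s : Term S V}
    (h : Subterm a s) (ha : Step ok R a a') : ∃ s', Step ok R s s' ∧ Subterm a' s' := by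
  induction h with
  | refl => exact ⟨a', ha, .refl _⟩
  | arg f ts i _ ih =>
    obtain ⟨s', h1, h2⟩ := ih
    refine ⟨_, .arg f ts i s' h1, .arg f _ i ?_⟩
    simpa using h2

theorem NF.subterm {R : Set (Rule S V)} {a s : Term S V} (hs : NF R s) (h : Subterm a s) :
    NF R a := by
  intro u hu
  obtain ⟨s', h1, _⟩ := hu.exists_of_subterm h
  exact hs s' h1

theorem Step.subst {R : Set (Rule S V)} {s t : Term S V} (τ : V → Term S V)
    (h : Step (fun _ => True) R s t) :
    Step (fun _ => True) R (s.subst τ) (t.subst τ) := by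
  induction h with
  | root ρ hρ σ _ =>
    rw [subst_subst, subst_subst]
    exact .root ρ hρ _ fun _ _ => trivial
  | arg f ts i t _ ih =>
    have := Step.arg (R := R) (ok := fun _ => True) f (fun i => (ts i).subst τ) i _ ih
    rwa [← subst_app_update] at this

theorem NF.of_subst {R : Set (Rule S V)} {s : Term S V} (τ : V → Term S V)
    (h : NF R (s.subst τ)) : NF R s := fun _ hu => h _ (hu.subst τ)

theorem Step.root_mem_funs {ok : Term S V → Prop} {R : Set (Rule S V)}
    (hR : ∀ ρ ∈ R, ∀ x, ρ.lhs ≠ var x) {s t : Term S V} (h : Step ok R s t) :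
    ∃ f ∈ Defined R, f ∈ s.funs := by
  induction h with
  | root ρ hρ σ _ =>
    obtain ⟨l, r⟩ := ρ
    cases l with
    | var x => exact absurd rfl (hR _ hρ x)
    | app f ls => exact ⟨f, ⟨_, hρ, ls, rfl⟩, mem_funs_subst.2 (.inl (mem_funs_app.2 (.inl rfl)))⟩
  | arg f ts i t _ ih =>
    obtain ⟨g, hg, hm⟩ := ih
    exact ⟨g, hg, mem_funs_app.2 (.inr ⟨i, hm⟩)⟩

theorem NF.of_constructor {R : Set (Rule S V)} (hR : ∀ ρ ∈ R, ∀ x, ρ.lhs ≠ var x)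
    {s : Term S V} (h : ∀ g ∈ s.funs, g ∉ Defined R) : NF R s := by
  intro u hu
  obtain ⟨f, hf, hm⟩ := hu.root_mem_funs hR
  exact h f hm hf

end StepBasics

/-! ### Usable replacement maps: non-replacing subterms stay normal -/

section ReplacementMaps

variable {S : Sig.{u}} {V : Type v}

/-- All subterms at positions that are not `μ`-replacing are normal forms. -/
def NonReplNF (R : Set (Rule S V)) (μ : ReplMap S) (s : Term S V) : Prop :=
  ∀ t, NonRepl μ s t → NF R t

theorem NonReplNF.arg {R : Set (Rule S V)} {μ : ReplMap S} {f : S.Sym}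
    {ts : Fin (S.ar f) → Term S V} (h : NonReplNF R μ (app f ts)) (i : Fin (S.ar f)) :
    NonReplNF R μ (ts i) := fun t ht => h t (.inside f ts i ht)

theorem NonRepl.subst {μ : ReplMap S} {s t : Term S V} (h : NonRepl μ s t) (σ : V → Term S V) :
    NonRepl μ (s.subst σ) (t.subst σ) := by
  induction h with
  | here f ts i hi ht => exact .here f _ i hi (ht.subst σ)
  | inside f ts i _ ih => exact .inside f (fun i => (ts i).subst σ) i ih

theorem NonRepl.of_subterm {μ : ReplMap S} {a s t : Term S V} (h : Subterm a s)
    (ha : NonRepl μ a t) : NonRepl μ s t := by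
  induction h with
  | refl => exact ha
  | arg f ts i _ ih => exact .inside f ts i ih

theorem NonRepl.exists_isArg {μ : ReplMap S} {s t : Term S V} (h : NonRepl μ s t) :
    ∃ u, IsArg u s ∧ Subterm t u := by
  induction h with
  | here f ts i _ ht => exact ⟨ts i, ⟨f, ts, i, rfl, rfl⟩, ht⟩
  | inside f ts i _ ih =>
    obtain ⟨u, ⟨g, us, j, h1, h2⟩, h3⟩ := ih
    exact ⟨ts i, ⟨f, ts, i, rfl, rfl⟩, h3.trans (h1 ▸ h2 ▸ .arg g us j (.refl _))⟩

/-- Instances of terms that equal their cap are normal forms. -/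
theorem CapFix.nf {R : Set (Rule S V)} {μ : ReplMap S} {l : Term S V} {σ : V → Term S V}
    (hl : ∀ t, NonRepl μ l t → NF R (t.subst σ)) (u : Term S V) :
    ∀ p, CapFix R μ l u p → NF R (u.subst σ) := by
  induction u with
  | var x =>
    intro p hp
    unfold CapFix cap at hp
    by_cases hn : NonRepl μ l (var x)
    · exact hl _ hn
    · rw [if_neg hn] at hp
      simp [Term.subst] at hp
  | app f ts ih =>
    intro p hp
    by_cases hn : NonRepl μ l (app f ts)
    · exact hl _ hn
    unfold CapFix cap at hp
    rw [if_neg hn] at hp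
    by_cases hu : ∃ ρ ∈ R, Unifiable (app f fun i => cap R μ l (ts i) (p ++ [(i : ℕ)])) ρ.lhs
    · rw [if_pos hu] at hp
      simp [Term.subst] at hp
    rw [if_neg hu] at hp
    have hc : ∀ i, CapFix R μ l (ts i) (p ++ [(i : ℕ)]) := by
      simp only [Term.subst, app.injEq, heq_eq_eq, true_and] at hp
      exact fun i => congrFun hp i
    intro w hw
    generalize hs : (app f ts).subst σ = s at hw
    cases hw with
    | root ρ hρ τ _ =>
      -- A redex here would unify the capped term with `ρ.lhs`. The arguments equal their caps, so
      -- no fresh variable occurs and the value on `Sum.inr` is arbitrary.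
      refine hu ⟨ρ, hρ, Sum.elim σ fun _ => ρ.lhs, τ, ?_⟩
      rw [← hs]
      simp only [Term.subst, app.injEq, heq_eq_eq, true_and]
      funext i
      rw [hc i, subst_subst]
      rfl
    | arg g us i w' hw' =>
      simp only [Term.subst] at hs
      cases hs
      exact ih i _ (hc i) w' hw'

/-- A rewrite step whose position is `μ`-replacing. -/
inductive MuStep (μ : ReplMap S) (ok : Term S V → Prop) (R : Set (Rule S V)) :
    Term S V → Term S V → Prop
  | root (ρ : Rule S V) (hρ : ρ ∈ R) (σ : V → Term S V)
      (hok : ∀ u, IsArg u (ρ.lhs.subst σ) → ok u) :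
      MuStep μ ok R (ρ.lhs.subst σ) (ρ.rhs.subst σ)
  | arg (f : S.Sym) (ts : Fin (S.ar f) → Term S V) (i : Fin (S.ar f)) (t : Term S V) :
      i ∈ μ f → MuStep μ ok R (ts i) t → MuStep μ ok R (app f ts) (app f (Function.update ts i t))

/-- A non-replacing argument is a normal form, so a step cannot pass through it. -/
theorem NonReplNF.muStep {N R : Set (Rule S V)} {μ : ReplMap S} {ok : Term S V → Prop}
    (hRN : R ⊆ N) {s t : Term S V} (hs : NonReplNF N μ s) (h : Step ok R s t) :
    MuStep μ ok R s t := by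
  induction h with
  | root ρ hρ σ hok => exact .root ρ hρ σ hok
  | arg f ts i t h ih =>
    by_cases hi : i ∈ μ f
    · exact .arg f ts i t hi (ih (hs.arg i))
    · exact absurd (h.mono (fun _ h => h) hRN) (hs _ (.here f ts i hi (.refl _))).not_step

/-- The step passes through replacing arguments only. A non-replacing subterm of the result
therefore sits in an untouched argument or is created by the contraction itself, which is the only
case left to `hroot`. -/
theorem MuStep.nonReplNF {N R : Set (Rule S V)} {μ : ReplMap S} {ok : Term S V → Prop}
    (hroot : ∀ ρ ∈ R, ∀ σ : V → Term S V, (∀ u, IsArg u (ρ.lhs.subst σ) → ok u) →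
      NonReplNF N μ (ρ.lhs.subst σ) → NonReplNF N μ (ρ.rhs.subst σ))
    {s t : Term S V} (h : MuStep μ ok R s t) (hs : NonReplNF N μ s) : NonReplNF N μ t := by
  induction h with
  | root ρ hρ σ hok => exact hroot ρ hρ σ hok hs
  | arg f ts i t hi _ ih =>
    intro w hw
    cases hw with
    | here _ _ j hj hw =>
      have hji : j ≠ i := fun e => hj (e ▸ hi)
      rw [Function.update_of_ne hji] at hw
      exact hs w (.here f ts j hj hw)
    | inside _ _ j hw =>
      by_cases hji : j = i
      · subst hji
        rw [Function.update_self] at hw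
        exact ih (hs.arg j) w hw
      · rw [Function.update_of_ne hji] at hw
        exact hs w (.inside f ts j hw)

theorem upsilon_usableMap_full (R : Set (Rule S V)) :
    upsilon R (usableMap .full R) = usableMap .full R :=
  OrderHom.map_lfp ⟨upsilon R, upsilon_mono R⟩

/-- Arguments that are not selected by the usable replacement map are instantiated to normal
forms by a step. -/
theorem nf_arg_of_not_mem_usableMap {st : Strategy} {R : Set (Rule S V)} {ρ : Rule S V}
    (hρ : ρ ∈ R) {σ : V → Term S V} (hok : ∀ u, IsArg u (ρ.lhs.subst σ) → st.ok R u)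
    (hl : NonReplNF R (usableMap st R) (ρ.lhs.subst σ)) {f : S.Sym}
    {rs : Fin (S.ar f) → Term S V} (hs : Subterm (app f rs) ρ.rhs) {i : Fin (S.ar f)}
    (hi : i ∉ usableMap st R f) : NF R ((rs i).subst σ) := by
  cases st with
  | full =>
    rw [← upsilon_usableMap_full] at hi
    have hc : CapFix R (usableMap .full R) ρ.lhs (rs i) [] := by
      by_contra hc
      exact hi ⟨ρ, hρ, rs, hs, hc⟩
    exact CapFix.nf (fun t ht => hl _ (ht.subst σ)) _ _ hc
  | innermost =>
    have hc : CapFix R ⊥ ρ.lhs (rs i) [] := by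
      by_contra hc
      exact hi ⟨ρ, hρ, rs, hs, hc⟩
    refine CapFix.nf (fun t ht => ?_) _ _ hc
    -- A non-replacing position is never the root, so the subterm lies in an argument of the redex,
    -- which is normal under the innermost strategy. This is why one application of `upsilon` to the
    -- empty map is enough.
    obtain ⟨u, hu, ht⟩ := ht.exists_isArg
    exact NF.subterm (hok _ (hu.subst σ)) (ht.subst σ)

/-- A non-replacing subterm of the contractum either lies below a function position of the
right-hand side, where the usable map guarantees normality, or inside the instance of a variable,
which already occurs in the redex. -/
theorem NonReplNF.root {st : Strategy} {R : Set (Rule S V)}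
    (hvars : ∀ ρ ∈ R, ρ.rhs.vars ⊆ ρ.lhs.vars) {ρ : Rule S V}
    (hρ : ρ ∈ R) {σ : V → Term S V} (hok : ∀ u, IsArg u (ρ.lhs.subst σ) → st.ok R u)
    (hl : NonReplNF R (usableMap st R) (ρ.lhs.subst σ)) :
    NonReplNF R (usableMap st R) (ρ.rhs.subst σ) := by
  suffices H : ∀ r, Subterm r ρ.rhs → NonReplNF R (usableMap st R) (r.subst σ) from
    H _ (.refl _)
  intro r
  induction r with
  | var x =>
    intro hr t ht
    exact hl t (.of_subterm (Term.Subterm.subst (hvars ρ hρ hr) σ) ht)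
  | app f rs ih =>
    intro hr t ht
    cases ht with
    | here _ _ i hi ht =>
      exact (nf_arg_of_not_mem_usableMap hρ hok hl hr hi).subterm ht
    | inside _ _ i ht => exact ih i (.trans (.arg f rs i (.refl _)) hr) t ht

theorem NonReplNF.step {st : Strategy} {R : Set (Rule S V)}
    (hvars : ∀ ρ ∈ R, ρ.rhs.vars ⊆ ρ.lhs.vars) {s t : Term S V}
    (hs : NonReplNF R (usableMap st R) s) (h : Step (st.ok R) R s t) :
    NonReplNF R (usableMap st R) t :=
  (hs.muStep subset_rfl h).nonReplNF (fun _ hρ _ hok => NonReplNF.root hvars hρ hok) hs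

end ReplacementMaps

/-! ### Transfer between the original and the extended signature -/

section Embedding

variable {S : Sig.{u}} {V : Type v}

theorem emb_subst (σ : V → Term S V) (t : Term S V) :
    (emb t).subst (fun x => emb (σ x)) = emb (t.subst σ) := by
  induction t with
  | var x => rfl
  | app f ts ih =>
    simp only [emb, Term.subst, app.injEq, heq_eq_eq, true_and]
    funext i
    exact ih i

theorem mark_app_subst (σ : V → Term S V) (f : S.Sym) (ts : Fin (S.ar f) → Term S V) :
    (mark (app f ts)).subst (fun x => emb (σ x)) = mark ((app f ts).subst σ) := by
  simp only [mark, Term.subst, app.injEq, heq_eq_eq, true_and]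
  funext i
  exact emb_subst σ (ts i)

theorem mark_subst {l : Term S V} (hl : ∀ x, l ≠ var x) (σ : V → Term S V) :
    (mark l).subst (fun x => emb (σ x)) = mark (l.subst σ) := by
  cases l with
  | var x => exact absurd rfl (hl x)
  | app f ts => exact mark_app_subst σ f ts

theorem apply_update {n : ℕ} {α β : Type*} (g : α → β) (ts : Fin n → α) (i : Fin n) (t : α) :
    (fun j => g (Function.update ts i t j)) = Function.update (fun j => g (ts j)) i (g t) :=
  Function.comp_update g ts i t

theorem emb_app_update (f : S.Sym) (ts : Fin (S.ar f) → Term S V) (i : Fin (S.ar f))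
    (t : Term S V) : emb (app f (Function.update ts i t)) =
      app (S := S.ext V) (ExtSym.base f) (Function.update (fun i => emb (ts i)) i (emb t)) := by
  simp only [emb, app.injEq, heq_eq_eq, true_and]
  exact apply_update emb ts i t

theorem mark_app_update (f : S.Sym) (ts : Fin (S.ar f) → Term S V) (i : Fin (S.ar f))
    (t : Term S V) : mark (app f (Function.update ts i t)) =
      app (S := S.ext V) (ExtSym.sharp f) (Function.update (fun i => emb (ts i)) i (emb t)) := by
  simp only [mark, app.injEq, heq_eq_eq, true_and]
  exact apply_update emb ts i t

theorem mem_funs_emb {t : Term S V} {g : ExtSym S V} :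
    g ∈ (emb t).funs ↔ ∃ f ∈ t.funs, g = ExtSym.base f := by
  induction t with
  | var x =>
    have h1 : g ∉ (var x : Term (S.ext V) V).funs := not_mem_funs_var
    simpa [emb, h1] using fun f hf => absurd hf not_mem_funs_var
  | app f ts ih =>
    simp only [emb]
    rw [mem_funs_app (S := S.ext V)]
    simp only [mem_funs_app]
    constructor
    · rintro (h | ⟨i, h⟩)
      · exact ⟨f, .inl rfl, h⟩
      · obtain ⟨g', hg, rfl⟩ := (ih i).1 h
        exact ⟨g', .inr ⟨i, hg⟩, rfl⟩
    · rintro ⟨g', rfl | ⟨i, h⟩, rfl⟩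
      · exact .inl rfl
      · exact .inr ⟨i, (ih i).2 ⟨g', h, rfl⟩⟩

theorem vars_emb (t : Term S V) : (emb t).vars = t.vars := by
  induction t with
  | var x => ext y; simp [emb, mem_vars_var]
  | app f ts ih =>
    ext y
    simp only [emb]
    rw [mem_vars_app (S := S.ext V), mem_vars_app]
    exact exists_congr fun i => by rw [ih i]

theorem vars_mark (t : Term S V) : (mark t).vars = t.vars := by
  cases t with
  | var x => ext y; simp [mark, mem_vars_var]
  | app f ts =>
    ext y
    simp only [mark]
    rw [mem_vars_app (S := S.ext V), mem_vars_app]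
    exact exists_congr fun i => by rw [vars_emb (ts i)]

/-- A left inverse of `emb`, with the value `d` at terms whose root is a new symbol. -/
def unemb (d : Term S V) : Term (S.ext V) V → Term S V
  | var x => var x
  | app (.base f) ts => app f fun i => unemb d (ts i)
  | app (.sharp _) _ => d
  | app (.com _ _) _ => d

theorem unemb_emb (d : Term S V) (t : Term S V) : unemb d (emb t) = t := by
  induction t with
  | var x => rfl
  | app f ts ih =>
    simp only [emb, unemb, app.injEq, heq_eq_eq, true_and]
    funext i
    exact ih i

theorem unemb_subst (d : Term S V) (σ : V → Term (S.ext V) V) (t : Term S V) :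
    unemb d ((emb t).subst σ) = t.subst fun x => unemb d (σ x) := by
  induction t with
  | var x => rfl
  | app f ts ih =>
    simp only [emb, Term.subst, unemb, app.injEq, heq_eq_eq, true_and]
    funext i
    exact ih i

theorem mark_subst_ne_emb {l : Term S V} (hl : ∀ x, l ≠ var x) (σ : V → Term (S.ext V) V)
    (a : Term S V) : (mark l).subst σ ≠ emb a := by
  intro h
  cases l with
  | var x => exact hl x rfl
  | app f ts =>
    cases a with
    | var x => simp [mark, emb, Term.subst] at h
    | app g us =>
      simp only [mark, emb, Term.subst] at h
      injection h with h1
      cases h1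

/-- Marked left-hand sides cannot match an embedded term, so only embedded rules apply, and these
project back to `R`. The substitution may take values outside the image of `emb`, hence the default
`d`. -/
theorem Step.unemb {R : Set (Rule S V)} {X : Set (Rule (S.ext V) V)}
    (hX : ∀ p ∈ X, (∃ ρ ∈ R, p = embRule ρ) ∨ ∃ l, (∀ x, l ≠ var x) ∧ p.lhs = mark l)
    (d : Term S V) {s u : Term (S.ext V) V} (h : Step (fun _ => True) X s u) :
    ∀ a : Term S V, s = emb a → Step (fun _ => True) R a (unemb d u) := by
  induction h with
  | root p hp σ _ =>
    intro a ha
    rcases hX p hp with ⟨ρ, hρ, rfl⟩ | ⟨l, hl, hm⟩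
    · have h1 : a = ρ.lhs.subst fun x => RC.unemb d (σ x) := by
        rw [← unemb_emb d a, ← ha]
        exact unemb_subst d σ _
      rw [h1]
      change Step _ R _ (RC.unemb d ((emb ρ.rhs).subst σ))
      rw [unemb_subst]
      exact .root ρ hρ _ fun _ _ => trivial
    · rw [hm] at ha
      exact absurd ha (mark_subst_ne_emb hl σ a)
  | arg f ts i t _ ih =>
    intro a ha
    cases a with
    | var x => simp [emb] at ha
    | app g us =>
      simp only [emb] at ha
      injection ha with h1 h2
      subst h1
      have h2 := eq_of_heq h2
      subst h2
      have := Step.arg (R := R) (ok := fun _ => True) g us i _ (ih (us i) rfl)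
      convert this using 1
      simp only [RC.unemb, app.injEq, heq_eq_eq, true_and]
      refine Eq.trans (apply_update (RC.unemb d) (fun j => RC.emb (us j)) i t) ?_
      simp only [unemb_emb]

theorem NF.emb {R : Set (Rule S V)} {X : Set (Rule (S.ext V) V)}
    (hX : ∀ p ∈ X, (∃ ρ ∈ R, p = embRule ρ) ∨ ∃ l, (∀ x, l ≠ var x) ∧ p.lhs = mark l)
    {a : Term S V} (h : NF R a) : NF X (emb a) :=
  fun _ hu => h _ (hu.unemb hX a a rfl)

/-- This lets the innermost condition with respect to `R` be replaced by the one with respect to the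
pairs and usable rules of any path. -/
theorem Strategy.ok_emb {st : Strategy} {R : Set (Rule S V)} {X : Set (Rule (S.ext V) V)}
    (hX : ∀ p ∈ X, (∃ ρ ∈ R, p = embRule ρ) ∨ ∃ l, (∀ x, l ≠ var x) ∧ p.lhs = mark l)
    {a : Term S V} (h : st.ok R a) : st.ok X (emb a) := by
  cases st with
  | full => trivial
  | innermost => exact NF.emb hX h

theorem isArg_emb {u : Term (S.ext V) V} {t : Term S V} (h : IsArg u (emb t)) :
    ∃ a, IsArg a t ∧ u = emb a := by
  obtain ⟨f, ts, i, h1, rfl⟩ := h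
  cases t with
  | var x => simp [emb] at h1
  | app g us =>
    simp only [emb] at h1
    cases h1
    exact ⟨us i, ⟨g, us, i, rfl, rfl⟩, rfl⟩

theorem isArg_mark {u : Term (S.ext V) V} {t : Term S V} (h : IsArg u (mark t)) :
    ∃ a, IsArg a t ∧ u = emb a := by
  obtain ⟨f, ts, i, h1, rfl⟩ := h
  cases t with
  | var x => simp [mark] at h1
  | app g us =>
    simp only [mark] at h1
    cases h1
    exact ⟨us i, ⟨g, us, i, rfl, rfl⟩, rfl⟩

/-- Only rules whose root symbol occurs in `a` can be applied in `a`. With this weak demand on `X`,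
the usable rules suffice as soon as all defined symbols of `a` are usable. -/
theorem Step.emb {R : Set (Rule S V)} {X : Set (Rule (S.ext V) V)} {ok : Term S V → Prop}
    {ok' : Term (S.ext V) V → Prop} (hok : ∀ t, ok t → ok' (emb t)) {a a' : Term S V}
    (h : Step ok R a a')
    (hX : ∀ ρ ∈ R, ∀ f ls, ρ.lhs = app f ls → f ∈ a.funs → embRule ρ ∈ X)
    (hR : ∀ ρ ∈ R, ∀ x, ρ.lhs ≠ var x) :
    Step ok' X (emb a) (emb a') := by
  induction h with
  | root ρ hρ σ ho =>
    rw [← emb_subst, ← emb_subst]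
    refine Step.root (embRule ρ) ?_ (fun x => RC.emb (σ x)) ?_
    · obtain ⟨l, r⟩ := ρ
      cases l with
      | var x => exact absurd rfl (hR _ hρ x)
      | app f ls =>
        exact hX _ hρ f ls rfl (mem_funs_subst.2 (.inl (mem_funs_app.2 (.inl rfl))))
    · intro u hu
      change IsArg u ((RC.emb ρ.lhs).subst _) at hu
      rw [emb_subst] at hu
      obtain ⟨a, ha, rfl⟩ := isArg_emb hu
      exact hok _ (ho a ha)
  | arg f ts i t _ ih =>
    rw [emb_app_update]
    exact Step.arg (S := S.ext V) (ExtSym.base f) (fun i => RC.emb (ts i)) i _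
      (ih fun ρ hρ g ls hl hg => hX ρ hρ g ls hl (mem_funs_app.2 (.inr ⟨i, hg⟩)))

end Embedding

/-! ### Usable symbols are closed under rewriting -/

section UsableSymbols

variable {S : Sig.{u}} {V : Type v}

/-- All defined symbols of `t` are reachable from the right-hand sides of `P`. -/
def AllUsable (R : Set (Rule S V)) (P : Set (Rule (S.ext V) V)) (t : Term S V) : Prop :=
  ∀ f ∈ t.funs, f ∈ Defined R → ∃ p ∈ P, ∃ f₀ : S.Sym,
    ExtSym.base f₀ ∈ p.rhs.funs ∧ ReflTransGen (DependsOn R) f₀ f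

theorem AllUsable.mono {R : Set (Rule S V)} {P P' : Set (Rule (S.ext V) V)} (h : P ⊆ P')
    {t : Term S V} (ht : AllUsable R P t) : AllUsable R P' t := by
  intro f hf hd
  obtain ⟨p, hp, h'⟩ := ht f hf hd
  exact ⟨p, h hp, h'⟩

theorem AllUsable.step {R : Set (Rule S V)} {P : Set (Rule (S.ext V) V)} {ok : Term S V → Prop}
    (hR : IsTRS R) {s t : Term S V} (h : Step ok R s t) (hs : AllUsable R P s) :
    AllUsable R P t := by
  induction h with
  | root ρ hρ σ _ =>
    intro g hg hd
    rcases mem_funs_subst.1 hg with hg | ⟨x, hx, hg⟩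
    · obtain ⟨f, ls, hl⟩ : ∃ f ls, ρ.lhs = app f ls := by
        have := hR.lhs_ne_var ρ hρ
        cases h : ρ.lhs with
        | var x => exact absurd h (this x)
        | app f ls => exact ⟨f, ls, rfl⟩
      obtain ⟨p, hp, f₀, h1, h2⟩ := hs f
        (mem_funs_subst.2 (.inl (hl ▸ mem_funs_app.2 (.inl rfl)))) ⟨ρ, hρ, ls, hl⟩
      exact ⟨p, hp, f₀, h1, h2.tail ⟨hd, ρ, hρ, ⟨ls, hl⟩, hg⟩⟩
    · exact hs g (mem_funs_subst.2 (.inr ⟨x, hR.vars_subset ρ hρ hx, hg⟩)) hd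
  | arg f ts i t _ ih =>
    intro g hg hd
    rcases mem_funs_app.1 hg with rfl | ⟨j, hg⟩
    · exact hs g (mem_funs_app.2 (.inl rfl)) hd
    · by_cases hj : j = i
      · subst hj
        rw [Function.update_self] at hg
        exact ih (fun g hg => hs g (mem_funs_app.2 (.inr ⟨j, hg⟩))) g hg hd
      · rw [Function.update_of_ne hj] at hg
        exact hs g (mem_funs_app.2 (.inr ⟨j, hg⟩)) hd

theorem AllUsable.embRule_mem {R : Set (Rule S V)} {P : Set (Rule (S.ext V) V)} {t : Term S V}
    (h : AllUsable R P t) : ∀ ρ ∈ R, ∀ f ls, ρ.lhs = app f ls → f ∈ t.funs →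
      embRule ρ ∈ usableRules R P := by
  intro ρ hρ f ls hl hf
  obtain ⟨p, hp, f₀, h1, h2⟩ := h f hf ⟨ρ, hρ, ls, hl⟩
  exact ⟨ρ, ⟨hρ, p, hp, f₀, f, h1, h2, ls, hl⟩, rfl⟩

/-- The left-hand sides of sets of pairs and usable rules. -/
theorem pairs_usable_lhs {st : Strategy} {R : Set (Rule S V)} (hR : IsTRS R)
    {Q : Set (Rule (S.ext V) V)} (hQ : Q ⊆ weakPairs st R) :
    ∀ p ∈ Q ∪ usableRules R Q,
      (∃ ρ ∈ R, p = embRule ρ) ∨ ∃ l, (∀ x, l ≠ var x) ∧ p.lhs = mark l := by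
  rintro p (hp | ⟨ρ, ⟨hρ, _⟩, rfl⟩)
  · obtain ⟨ρ, hρ, rfl⟩ := hQ hp
    exact .inr ⟨ρ.lhs, hR.lhs_ne_var ρ hρ, rfl⟩
  · exact .inl ⟨ρ, hρ, rfl⟩

end UsableSymbols

/-! ### Monotonicity of matrix interpretations -/

section Evaluation

variable {S : Sig.{u}} {V : Type v} {W : Type w} (A : MatInt S)

theorem MatInt.eval_subst (α : W → Fin (A.dim + 1) → ℕ) (σ : V → Term S W) (t : Term S V) :
    A.eval α (t.subst σ) = A.eval (fun x => A.eval α (σ x)) t := by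
  induction t with
  | var x => rfl
  | app f ts ih =>
    simp only [Term.subst, MatInt.eval]
    congr 1
    funext i
    exact ih i

theorem MatInt.eval_update (α : V → Fin (A.dim + 1) → ℕ) (f : S.Sym)
    (ts : Fin (S.ar f) → Term S V) (i : Fin (S.ar f)) (t : Term S V) :
    A.eval α (app f (Function.update ts i t)) =
      A.interp f (Function.update (fun j => A.eval α (ts j)) i (A.eval α t)) := by
  simp only [MatInt.eval]
  congr 1
  exact Function.comp_update (A.eval α) ts i t

theorem MatInt.interp_mono (f : S.Sym) {vs ws : Fin (S.ar f) → Fin (A.dim + 1) → ℕ}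
    (h : ∀ i, vs i ≤ ws i) : A.interp f vs ≤ A.interp f ws := by
  unfold MatInt.interp
  refine add_le_add (Finset.sum_le_sum fun i _ => fun j => ?_) le_rfl
  simp only [Matrix.mulVec, dotProduct]
  exact Finset.sum_le_sum fun k _ => Nat.mul_le_mul_left _ (h i k)

theorem MatInt.Ge.arg {f : S.Sym} {ts : Fin (S.ar f) → Term S V} {i : Fin (S.ar f)}
    {t : Term S V} (h : A.Ge (ts i) t) : A.Ge (app f ts) (app f (Function.update ts i t)) := by
  intro α
  rw [A.eval_update]
  refine A.interp_mono f fun j => ?_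
  by_cases hj : j = i
  · subst hj; simpa using h α
  · simp [hj]

/-- Matrices over `ℕ` are weakly monotone in every argument, so the position of the step does not
matter. -/
theorem MatInt.Ge.step {ok : Term S V → Prop} {R : Set (Rule S V)}
    (hR : ∀ ρ ∈ R, A.Ge ρ.lhs ρ.rhs) {s t : Term S V} (h : Step ok R s t) : A.Ge s t := by
  induction h with
  | root ρ hρ σ _ =>
    intro α
    rw [A.eval_subst, A.eval_subst]
    exact hR ρ hρ _
  | arg f ts i t _ ih => exact ih.arg

theorem MatInt.Gt.muStep {μ : ReplMap S} {ok : Term S V → Prop} {R : Set (Rule S V)}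
    (hμ : A.MuMonotone μ) (hR : A.Compatible R) {s t : Term S V} (h : MuStep μ ok R s t) :
    A.Gt s t := by
  induction h with
  | root ρ hρ σ _ =>
    intro α
    rw [A.eval_subst, A.eval_subst]
    exact hR ρ hρ _
  | arg f ts i t hi _ ih =>
    intro α
    rw [A.eval_update]
    exact hμ f i hi _ _ (ih α)

/-- With the unit matrix, the first component of the argument enters the value exactly once, so an
increase passes through unamplified. This is the purpose of adequacy. -/
theorem MatInt.interp_update_le {f : S.Sym} {i : Fin (S.ar f)} (h1 : A.mat f i = 1)
    (vs : Fin (S.ar f) → Fin (A.dim + 1) → ℕ) (v : Fin (A.dim + 1) → ℕ) {Δ : ℕ}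
    (hv : v 0 ≤ vs i 0 + Δ) :
    A.interp f (Function.update vs i v) 0 ≤ A.interp f vs 0 + Δ := by
  unfold MatInt.interp
  rw [← Finset.add_sum_erase _ _ (Finset.mem_univ i),
    ← Finset.add_sum_erase _ (fun i => (A.mat f i).mulVec (vs i)) (Finset.mem_univ i)]
  have : ∑ x ∈ Finset.univ.erase i, (A.mat f x).mulVec (Function.update vs i v x) =
      ∑ x ∈ Finset.univ.erase i, (A.mat f x).mulVec (vs x) :=
    Finset.sum_congr rfl fun j hj => by
      have : j ≠ i := by simpa using hj
      rw [Function.update_of_ne this]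
  rw [this, h1]
  simp only [Function.update_self, Matrix.one_mulVec, Pi.add_apply]
  omega

end Evaluation

/-! ### Counting the steps of a derivation by interpretations -/

section Derivations

variable {S : Sig.{u}} {V : Type v}

/-- A compound symbol applied to a vector of terms. -/
def comTerm (n : ℕ) (ρ : Rule S V) (ts : Fin n → Term (S.ext V) V) : Term (S.ext V) V :=
  app (S := S.ext V) (ExtSym.com n ρ) ts

/-- A rewrite step that takes place beneath compound symbols only. -/
inductive ComStep (ok : Term (S.ext V) V → Prop) (X : Set (Rule (S.ext V) V)) :
    Term (S.ext V) V → Term (S.ext V) V → Prop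
  | root (p : Rule (S.ext V) V) (hp : p ∈ X) (σ : V → Term (S.ext V) V)
      (hok : ∀ u, IsArg u (p.lhs.subst σ) → ok u) :
      ComStep ok X (p.lhs.subst σ) (p.rhs.subst σ)
  | arg (n : ℕ) (ρ : Rule S V) (ts : Fin n → Term (S.ext V) V) (i : Fin n)
      (t : Term (S.ext V) V) : ComStep ok X (ts i) t →
      ComStep ok X (comTerm n ρ ts)
        (comTerm n ρ (Function.update ts i t))

theorem ComStep.step {ok : Term (S.ext V) V → Prop} {X : Set (Rule (S.ext V) V)}
    {s t : Term (S.ext V) V} (h : ComStep ok X s t) : Step ok X s t := by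
  induction h with
  | root p hp σ hok => exact .root p hp σ hok
  | arg n ρ ts i t _ ih => exact Step.arg (S := S.ext V) (ExtSym.com n ρ) ts i t ih

/-- The position of a step beneath compound symbols is replacing if all non-replacing subterms
are normal forms. -/
theorem NonReplNF.mem_com {N X : Set (Rule (S.ext V) V)} {μ : ReplMap (S.ext V)}
    {ok : Term (S.ext V) V → Prop} (hX : X ⊆ N) {n : ℕ} {ρ : Rule S V}
    {ts : Fin n → Term (S.ext V) V} {i : Fin n} {t : Term (S.ext V) V}
    (hs : NonReplNF N μ (comTerm n ρ ts))
    (h : ComStep ok X (ts i) t) : i ∈ μ (ExtSym.com n ρ) := by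
  by_contra hi
  exact (hs _ (.here (S := S.ext V) (ExtSym.com n ρ) ts i hi (.refl _))).not_step
    (h.step.mono (fun _ h => h) hX)

theorem ComStep.gt {N X : Set (Rule (S.ext V) V)} {μ : ReplMap (S.ext V)}
    {ok : Term (S.ext V) V → Prop} {B : MatInt (S.ext V)} (hXN : X ⊆ N)
    (hcom : ∀ (n : ℕ) (ρ : Rule S V),
      MonoOn (B.Gt (V := V)) (ExtSym.com n ρ) (μ (ExtSym.com n ρ)))
    (hX : ∀ p ∈ X, B.Gt p.lhs p.rhs) {s t : Term (S.ext V) V} (h : ComStep ok X s t)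
    (hs : NonReplNF N μ s) : B.Gt s t := by
  induction h with
  | root p hp σ _ =>
    intro α
    rw [B.eval_subst, B.eval_subst]
    exact hX p hp _
  | arg n ρ ts i t h ih => exact hcom n ρ i (hs.mem_com hXN h) ts t (ih (hs.arg i))

theorem ComStep.gap {N X : Set (Rule (S.ext V) V)} {μ : ReplMap (S.ext V)}
    {ok : Term (S.ext V) V → Prop} {A : MatInt (S.ext V)} (hXN : X ⊆ N)
    (hA : Adequate μ A) {Δ : ℕ} (hΔ : Δ ∈ upperBounds (A.gapSet X))
    {s t : Term (S.ext V) V} (h : ComStep ok X s t)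
    (hs : NonReplNF N μ s) : A.eval₀ t 0 ≤ A.eval₀ s 0 + Δ := by
  induction h with
  | root p hp σ _ =>
    -- The gap bounds all assignments, in particular the one obtained by evaluating the matching
    -- substitution.
    have := hΔ ⟨p, hp, fun x => A.eval (fun _ => 0) (σ x), rfl⟩
    unfold MatInt.eval₀
    rw [A.eval_subst, A.eval_subst]
    omega
  | arg n ρ ts i t h ih =>
    have hi := hs.mem_com hXN h
    have hu := A.eval_update (fun _ => 0) (ExtSym.com n ρ) ts i t
    refine (congrFun hu 0).trans_le ?_
    exact A.interp_update_le (hA n ρ i hi) _ _ (ih (hs.arg i))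

/-- `Deriv st N K Q U s x y z t`: there is a derivation from `s` to `t` with `z` steps by pairs
of `Q ⊇ K` beneath compound symbols, at least `x` of them by pairs of `K`, and `y` steps by rules
of `U`. The strategy refers to the normal forms of `N`. -/
inductive Deriv (st : Strategy) (N K Q U : Set (Rule (S.ext V) V)) :
    Term (S.ext V) V → ℕ → ℕ → ℕ → Term (S.ext V) V → Prop
  | refl (s : Term (S.ext V) V) : Deriv st N K Q U s 0 0 0 s
  | strict {s s' t : Term (S.ext V) V} {x y z : ℕ} : ComStep (st.ok N) K s s' →
      Deriv st N K Q U s' x y z t → Deriv st N K Q U s (x + 1) y (z + 1) t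
  | pair {s s' t : Term (S.ext V) V} {x y z : ℕ} : ComStep (st.ok N) Q s s' →
      Deriv st N K Q U s' x y z t → Deriv st N K Q U s x y (z + 1) t
  | rule {s s' t : Term (S.ext V) V} {x y z : ℕ} : Step (st.ok N) U s s' →
      Deriv st N K Q U s' x y z t → Deriv st N K Q U s x (y + 1) z t

variable {st : Strategy} {N K Q U : Set (Rule (S.ext V) V)}

theorem Deriv.trans {s t r : Term (S.ext V) V} {x y z x' y' z' : ℕ}
    (h : Deriv st N K Q U s x y z t) (h' : Deriv st N K Q U t x' y' z' r) :
    Deriv st N K Q U s (x + x') (y + y') (z + z') r := by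
  induction h with
  | refl s => simpa using h'
  | strict h _ ih =>
    have := Deriv.strict h (ih h')
    convert this using 1 <;> omega
  | pair h _ ih =>
    have := Deriv.pair h (ih h')
    convert this using 1; omega
  | rule h _ ih =>
    have := Deriv.rule h (ih h')
    convert this using 1; omega

theorem Deriv.com_arg (n : ℕ) (ρ : Rule S V) (i : Fin n) {s t : Term (S.ext V) V} {x y z : ℕ}
    (h : Deriv st N K Q U s x y z t) : ∀ ts : Fin n → Term (S.ext V) V, ts i = s →
    Deriv st N K Q U (comTerm n ρ ts) x y z
      (comTerm n ρ (Function.update ts i t)) := by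
  induction h with
  | refl s =>
    rintro ts rfl
    rw [Function.update_eq_self]
    exact .refl _
  | @strict s s' t x y z h _ ih =>
    rintro ts rfl
    have := ih (Function.update ts i s') (by simp)
    rw [Function.update_idem] at this
    exact .strict (.arg n ρ ts i _ h) this
  | @pair s s' t x y z h _ ih =>
    rintro ts rfl
    have := ih (Function.update ts i s') (by simp)
    rw [Function.update_idem] at this
    exact .pair (.arg n ρ ts i _ h) this
  | @rule s s' t x y z h _ ih =>
    rintro ts rfl
    have := ih (Function.update ts i s') (by simp)
    rw [Function.update_idem] at this
    exact .rule (Step.arg (S := S.ext V) (ExtSym.com n ρ) ts i _ h) this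

/-- The arguments are rewritten one after another, and the counts add up. -/
theorem Deriv.com (n : ℕ) (ρ : Rule S V) (ts ws : Fin n → Term (S.ext V) V) (x y z : Fin n → ℕ)
    (h : ∀ i, Deriv st N K Q U (ts i) (x i) (y i) (z i) (ws i)) :
    Deriv st N K Q U (comTerm n ρ ts) (∑ i, x i) (∑ i, y i) (∑ i, z i)
      (comTerm n ρ ws) := by
  classical
  suffices H : ∀ s : Finset (Fin n), Deriv st N K Q U (comTerm n ρ ts)
      (∑ i ∈ s, x i) (∑ i ∈ s, y i) (∑ i ∈ s, z i)
      (comTerm n ρ fun i => if i ∈ s then ws i else ts i) by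
    simpa using H Finset.univ
  intro s
  induction s using Finset.induction_on with
  | empty => simpa using Deriv.refl _
  | insert a s ha ih =>
    have h1 := (h a).com_arg n ρ a (fun i => if i ∈ s then ws i else ts i) (by simp [ha])
    have h2 := ih.trans h1
    rw [Finset.sum_insert ha, Finset.sum_insert ha, Finset.sum_insert ha, add_comm (x a),
      add_comm (y a), add_comm (z a)]
    convert h2 using 2
    funext i
    by_cases hi : i = a
    · subst hi; simp
    · simp [hi]

/-- The first component drops by at least one at each counted step and never rises, since all of `N`
is weakly oriented. Strict monotonicity is needed only at compound symbols, above the pair steps. -/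
theorem Deriv.strict_le {B : MatInt (S.ext V)} (hK : K ⊆ Q) (hN : N = Q ∪ U)
    (hvars : ∀ p ∈ N, p.rhs.vars ⊆ p.lhs.vars)
    (hcom : ∀ (n : ℕ) (ρ : Rule S V),
      MonoOn (B.Gt (V := V)) (ExtSym.com n ρ) (usableMap st N (ExtSym.com n ρ)))
    (hgt : ∀ p ∈ K, B.Gt p.lhs p.rhs) (hge : ∀ p ∈ N, B.Ge p.lhs p.rhs)
    {s t : Term (S.ext V) V} {x y z : ℕ} (h : Deriv st N K Q U s x y z t)
    (hs : NonReplNF N (usableMap st N) s) : x + B.eval₀ t 0 ≤ B.eval₀ s 0 := by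
  have hQN : Q ⊆ N := hN ▸ Set.subset_union_left
  have hUN : U ⊆ N := hN ▸ Set.subset_union_right
  induction h with
  | refl s => simp
  | strict h _ ih =>
    have h1 := (h.gt (hK.trans hQN) hcom hgt hs (fun _ => 0)).1
    have h2 := ih (hs.step hvars (h.step.mono (fun _ h => h) (hK.trans hQN)))
    unfold MatInt.eval₀ at *
    omega
  | pair h _ ih =>
    have h0 := h.step.mono (fun _ h => h) hQN
    have h1 : B.eval (fun _ => 0) _ 0 ≤ B.eval (fun _ => 0) _ 0 :=
      MatInt.Ge.step B hge h0 (fun _ => 0) 0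
    have h2 := ih (hs.step hvars h0)
    unfold MatInt.eval₀ at *
    omega
  | rule h _ ih =>
    have h0 := h.mono (fun _ h => h) hUN
    have h1 : B.eval (fun _ => 0) _ 0 ≤ B.eval (fun _ => 0) _ 0 :=
      MatInt.Ge.step B hge h0 (fun _ => 0) 0
    have h2 := ih (hs.step hvars h0)
    unfold MatInt.eval₀ at *
    omega

/-- Potential argument: a rule step costs one unit of the first component, and a pair step refunds
at most `Δ`. Reachability from `T` is carried along because the second form of weight gap concerns
reachable terms only. -/
theorem Deriv.rule_le {A : MatInt (S.ext V)} {T : Set (Term (S.ext V) V)} {Δ : ℕ} (hK : K ⊆ Q)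
    (hN : N = Q ∪ U) (hvars : ∀ p ∈ N, p.rhs.vars ⊆ p.lhs.vars)
    (hmon : A.MuMonotone (usableMap st N)) (hU : A.Compatible U)
    (had : Adequate (usableMap st N) A)
    (hgap : Δ ∈ upperBounds (A.gapSet Q) ∨ A.IsWeightGap st Q U T Δ)
    {s t : Term (S.ext V) V} {x y z : ℕ} (h : Deriv st N K Q U s x y z t)
    (hs : NonReplNF N (usableMap st N) s)
    (hT : ∃ t₀ ∈ T, ReflTransGen (st.rew N) t₀ s) :
    y + A.eval₀ t 0 ≤ A.eval₀ s 0 + Δ * z := by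
  have hQN : Q ⊆ N := hN ▸ Set.subset_union_left
  have hUN : U ⊆ N := hN ▸ Set.subset_union_right
  have hrew : st.rew N = Step (st.ok N) N := st.step_eq N N
  have hpair : ∀ s t, ComStep (st.ok N) Q s t → NonReplNF N (usableMap st N) s →
      (∃ t₀ ∈ T, ReflTransGen (st.rew N) t₀ s) →
      A.eval₀ t 0 ≤ A.eval₀ s 0 + Δ := by
    rintro s t h hs ⟨t₀, ht₀, hr⟩
    rcases hgap with hgap | hgap
    · exact h.gap hQN had hgap hs
    · subst hN
      refine hgap t₀ ht₀ s t hr ?_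
      rw [st.step_eq]
      exact h.step
  induction h with
  | refl s => simp
  | strict h _ ih =>
    have h0 := h.step.mono (fun _ h => h) (hK.trans hQN)
    -- Strict steps are pair steps too and are charged the same gap.
    have hc : ∀ {s t}, ComStep (st.ok N) K s t → ComStep (st.ok N) Q s t := by
      intro s t h
      induction h with
      | root p hp σ hok => exact .root p (hK hp) σ hok
      | arg n ρ ts i t _ ih => exact .arg n ρ ts i t ih
    have h1 := hpair _ _ (hc h) hs hT
    obtain ⟨t₀, ht₀, hr⟩ := hT
    have h2 := ih (hs.step hvars h0) ⟨t₀, ht₀, hr.tail (hrew ▸ h0)⟩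
    rw [Nat.mul_succ]
    omega
  | pair h _ ih =>
    have h0 := h.step.mono (fun _ h => h) hQN
    have h1 := hpair _ _ h hs hT
    obtain ⟨t₀, ht₀, hr⟩ := hT
    have h2 := ih (hs.step hvars h0) ⟨t₀, ht₀, hr.tail (hrew ▸ h0)⟩
    rw [Nat.mul_succ]
    omega
  | rule h _ ih =>
    have h0 := h.mono (fun _ h => h) hUN
    have h1 := (MatInt.Gt.muStep A hmon hU (hs.muStep hUN h) (fun _ => 0)).1
    obtain ⟨t₀, ht₀, hr⟩ := hT
    have h2 := ih (hs.step hvars h0) ⟨t₀, ht₀, hr.tail (hrew ▸ h0)⟩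
    unfold MatInt.eval₀ at *
    omega

end Derivations

/-! ### Source paths in the congruence graph -/

section CongruenceGraph

variable {S : Sig.{u}} {V : Type v} {st : Strategy} {R : Set (Rule S V)}

theorem setOf_nodup_list_finite {α : Type*} {s : Set α} (hs : s.Finite) :
    {l : List α | l.Nodup ∧ ∀ x ∈ l, x ∈ s}.Finite := by
  classical
  have := hs.fintype
  refine Set.Finite.subset (Set.finite_range
    fun l : {l : List s // l.Nodup} => l.1.map Subtype.val) ?_
  rintro l ⟨hl, hm⟩
  lift l to List s using hm
  exact ⟨⟨l, hl.of_map _⟩, rfl⟩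

/-- The strongly connected component of a pair. -/
def scc (st : Strategy) (R : Set (Rule S V)) (p : Rule (S.ext V) V) : Set (Rule (S.ext V) V) :=
  {q | q ∈ weakPairs st R ∧ ReflTransGen (GraphEdge st R) p q ∧
    ReflTransGen (GraphEdge st R) q p}

theorem isSCC_scc {p : Rule (S.ext V) V} (hp : p ∈ weakPairs st R) : IsSCC st R (scc st R p) :=
  ⟨p, hp, rfl⟩

theorem mem_scc_self {p : Rule (S.ext V) V} (hp : p ∈ weakPairs st R) : p ∈ scc st R p :=
  ⟨hp, .refl, .refl⟩

theorem scc_eq {p q : Rule (S.ext V) V} (h : q ∈ scc st R p) : scc st R q = scc st R p := by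
  ext r
  exact ⟨fun hr => ⟨hr.1, h.2.1.trans hr.2.1, hr.2.2.trans h.2.2⟩,
    fun hr => ⟨hr.1, h.2.2.trans hr.2.1, hr.2.2.trans h.2.1⟩⟩

theorem IsSCC.eq_scc {K : Set (Rule (S.ext V) V)} (hK : IsSCC st R K) {p : Rule (S.ext V) V}
    (hp : p ∈ K) : K = scc st R p := by
  obtain ⟨q, hq, rfl⟩ := hK
  exact (scc_eq (st := st) hp).symm

theorem IsSCC.subset {K : Set (Rule (S.ext V) V)} (hK : IsSCC st R K) : K ⊆ weakPairs st R := by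
  obtain ⟨q, hq, rfl⟩ := hK
  exact fun p hp => hp.1

theorem weakPairs_finite (hR : IsTRS R) : (weakPairs st R).Finite := hR.finite.image _

/-- The strict reachability order on strongly connected components. -/
def SCCLt (st : Strategy) (R : Set (Rule S V)) (K L : Set (Rule (S.ext V) V)) : Prop :=
  IsSCC st R K ∧ IsSCC st R L ∧ K ≠ L ∧
    ∃ p ∈ K, ∃ q ∈ L, ReflTransGen (GraphEdge st R) p q

theorem SCCLt.trans {K L M : Set (Rule (S.ext V) V)} (h : SCCLt st R K L) (h' : SCCLt st R L M) :
    SCCLt st R K M := by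
  obtain ⟨hK, hL, hne, p, hp, q, hq, hpq⟩ := h
  obtain ⟨-, hM, -, q', hq', r, hr, hqr⟩ := h'
  rw [hL.eq_scc hq] at hq'
  have hqr := hq'.2.1.trans hqr
  refine ⟨hK, hM, ?_, p, hp, r, hr, hpq.trans hqr⟩
  rintro rfl
  rw [hK.eq_scc hp] at hr
  have : q ∈ scc st R p := ⟨hL.subset hq, hpq, hqr.trans hr.2.2⟩
  apply hne
  rw [hK.eq_scc hp, hL.eq_scc hq, scc_eq this]

/-- Reachability between distinct components is a strict order, so a path is strictly increasing. -/
theorem IsSourcePath.nodup {Ps : List (Set (Rule (S.ext V) V))} (h : IsSourcePath st R Ps) :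
    Ps.Nodup := by
  have hc : Ps.IsChain (SCCLt st R) := by
    obtain ⟨hS, -, hc⟩ := h
    refine List.IsChain.imp_of_mem_imp (fun K L hK hL hKL => ?_) hc
    obtain ⟨hne, p, hp, q, hq, he⟩ := hKL
    exact ⟨hS K hK, hS L hL, hne, p, hp, q, hq, .single he⟩
  have : IsTrans _ (SCCLt st R) := ⟨fun _ _ _ => SCCLt.trans⟩
  exact (List.isChain_iff_pairwise.1 hc).imp fun h => h.2.2.1

theorem setOf_isSourcePath_finite (hR : IsTRS R) : {Ps | IsSourcePath st R Ps}.Finite := by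
  have h1 : {K | IsSCC st R K}.Finite := (weakPairs_finite hR).finite_subsets.subset
    fun K hK => IsSCC.subset hK
  exact (setOf_nodup_list_finite h1).subset fun Ps h => ⟨h.nodup, h.1⟩

theorem IsSourcePath.append {Ps : List (Set (Rule (S.ext V) V))} {K L : Set (Rule (S.ext V) V)}
    (h : IsSourcePath st R (Ps ++ [K])) (hL : IsSCC st R L) (he : CongEdge st R K L) :
    IsSourcePath st R (Ps ++ [K] ++ [L]) := by
  obtain ⟨h1, ⟨K₀, h2, h3⟩, h4⟩ := h
  refine ⟨?_, ⟨K₀, ?_, h3⟩, ?_⟩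
  · intro M hM
    rcases List.mem_append.1 hM with hM | hM
    · exact h1 M hM
    · rw [List.mem_singleton.1 hM]; exact hL
  · rw [List.head?_append, h2]; rfl
  · refine List.isChain_append.2 ⟨h4, List.isChain_singleton _, ?_⟩
    simpa using he

/-- An edge either stays in the last component, and the path is kept, or it leaves it, and the path
grows by one component. -/
theorem IsSourcePath.exists_extension {Ps : List (Set (Rule (S.ext V) V))}
    {K : Set (Rule (S.ext V) V)} (h : IsSourcePath st R (Ps ++ [K])) {p q : Rule (S.ext V) V}
    (hp : p ∈ K) (he : GraphEdge st R p q) :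
    ∃ Ps', IsSourcePath st R (Ps' ++ [scc st R q]) ∧ Ps ++ [K] <+: Ps' ++ [scc st R q] := by
  by_cases hK : K = scc st R q
  · exact ⟨Ps, hK ▸ h, hK ▸ List.prefix_rfl⟩
  · exact ⟨Ps ++ [K], h.append (isSCC_scc he.2.1) ⟨hK, p, hp, q, mem_scc_self he.2.1, he⟩,
      List.prefix_append _ _⟩

/-- Walk backwards: a component that is not a source has a predecessor, and strictly fewer pairs
reach the predecessor. -/
theorem exists_isSourcePath (hR : IsTRS R) (p : Rule (S.ext V) V) (hp : p ∈ weakPairs st R) :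
    ∃ Ps, IsSourcePath st R (Ps ++ [scc st R p]) := by
  induction hn : {q | q ∈ weakPairs st R ∧ ReflTransGen (GraphEdge st R) q p}.ncard
    using Nat.strong_induction_on generalizing p with
  | _ n ih =>
    subst hn
    by_cases hs : IsSource st R (scc st R p)
    · refine ⟨[], ?_, ⟨_, rfl, hs⟩, List.isChain_singleton _⟩
      intro K hK
      rw [List.nil_append, List.mem_singleton] at hK
      rw [hK]
      exact isSCC_scc hp
    · unfold IsSource at hs
      push Not at hs
      obtain ⟨L, hL, hne, p', hp', q, hq, he⟩ := hs (isSCC_scc hp)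
      have hL' := hL.eq_scc hp'
      have hlt : {q | q ∈ weakPairs st R ∧ ReflTransGen (GraphEdge st R) q p'}.ncard <
          {q | q ∈ weakPairs st R ∧ ReflTransGen (GraphEdge st R) q p}.ncard := by
        refine Set.ncard_lt_ncard ⟨fun r hr => ⟨hr.1, hr.2.trans (.head he hq.2.2)⟩,
          fun hsub => hne ?_⟩ ((weakPairs_finite hR).subset fun r hr => hr.1)
        -- If no predecessor were lost, `p` would reach `p'`, and both would lie in the same
        -- component, contrary to `L` being a different one.
        have hpp := (hsub ⟨hp, .refl⟩ : p ∈ {q | q ∈ weakPairs st R ∧ _}).2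
        rw [hL']
        exact (scc_eq ⟨hp, .head he hq.2.2, hpp⟩).symm
      obtain ⟨Ps, hPs⟩ := ih _ hlt p' he.1 rfl
      rw [← hL'] at hPs
      exact ⟨_, hPs.append (isSCC_scc hp) ⟨hne, p', hp', q, hq, he⟩⟩

theorem unionList_mono {α : Type*} {Ps Ps' : List (Set α)} (h : Ps <+: Ps') :
    unionList Ps ⊆ unionList Ps' := by
  rintro p ⟨K, hK, hp⟩
  exact ⟨K, h.subset hK, hp⟩

theorem IsSourcePath.unionList_subset {Ps : List (Set (Rule (S.ext V) V))}
    (h : IsSourcePath st R Ps) : unionList Ps ⊆ weakPairs st R := by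
  rintro p ⟨K, hK, hp⟩
  exact (h.1 K hK).subset hp

end CongruenceGraph

/-! ### Splitting the length of a derivation among subterms -/

section SumSplit

/-- The number `n` is a sum of numbers that are related by `P` to the members of a list. -/
inductive SumSplit {α : Type*} (P : α → ℕ → Prop) : List α → ℕ → Prop
  | nil : SumSplit P [] 0
  | cons {u : α} {us : List α} {m n : ℕ} : P u m → SumSplit P us n →
      SumSplit P (u :: us) (m + n)

variable {α β : Type*} {P : α → ℕ → Prop}

theorem SumSplit.append {us vs : List α} {m n : ℕ} (h : SumSplit P us m) (h' : SumSplit P vs n) :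
    SumSplit P (us ++ vs) (m + n) := by
  induction h with
  | nil => simpa using h'
  | cons hu _ ih => rw [add_assoc]; exact .cons hu ih

theorem SumSplit.singleton {u : α} {m : ℕ} (h : P u m) : SumSplit P [u] m := .cons h .nil

theorem SumSplit.flatten : ∀ {k : ℕ} (L : Fin k → List α) (m : Fin k → ℕ),
    (∀ i, SumSplit P (L i) (m i)) → SumSplit P (List.ofFn L).flatten (∑ i, m i)
  | 0, L, m, _ => by simpa using SumSplit.nil
  | k + 1, L, m, h => by
    rw [List.ofFn_succ, List.flatten_cons, Fin.sum_univ_succ]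
    exact (h 0).append (SumSplit.flatten _ _ fun i => h i.succ)

/-- The bound `m ≤ n` is handed to `hg` so that an induction hypothesis on the length can be applied
to each part. -/
theorem SumSplit.map {P' : β → ℕ → Prop} {us : List α} {n : ℕ} (h : SumSplit P us n) (g : α → β)
    (hg : ∀ u ∈ us, ∀ m ≤ n, P u m → P' (g u) m) : SumSplit P' (us.map g) n := by
  induction h with
  | nil => exact .nil
  | cons hu _ ih =>
    exact .cons (hg _ (by simp) _ (by omega) hu)
      (ih fun v hv m hm => hg v (by simp [hv]) m (by omega))

theorem SumSplit.exists_fun {us : List α} {n : ℕ} (h : SumSplit P us n) :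
    ∃ m : Fin us.length → ℕ, ∑ i, m i = n ∧ ∀ i, P (us.get i) (m i) := by
  induction h with
  | nil => exact ⟨fun _ => 0, by simp, fun i => i.elim0⟩
  | @cons u us m n hu _ ih =>
    obtain ⟨k, hk, hP⟩ := ih
    refine ⟨(Fin.cons m k : Fin (us.length + 1) → ℕ), ?_, ?_⟩
    · exact (Fin.sum_univ_succ (Fin.cons m k : Fin (us.length + 1) → ℕ)).trans (by simp [hk])
    · intro i
      refine Fin.cases (n := us.length) ?_ (fun i => ?_) i
      · exact hu
      · exact hP i

end SumSplit

section Cuts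

variable {S : Sig.{u}} {V : Type v} {st : Strategy} {R : Set (Rule S V)}

/-- A constructor at the root is never contracted, so each step belongs to exactly one argument. -/
theorem iter_app {ok : Term S V → Prop} (hR : IsTRS R) {f : S.Sym} (hf : f ∉ Defined R) :
    ∀ (n : ℕ) (ts : Fin (S.ar f) → Term S V) (t : Term S V),
      iter (Step ok R) n (app f ts) t → ∃ m : Fin (S.ar f) → ℕ, ∑ i, m i = n ∧
        ∀ i, ∃ t, iter (Step ok R) (m i) (ts i) t
  | 0, ts, t, _ => ⟨fun _ => 0, by simp, fun i => ⟨ts i, rfl⟩⟩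
  | n + 1, ts, t, ⟨s, hs, ht⟩ => by
    generalize hu : app f ts = u at hs
    cases hs with
    | root ρ hρ σ _ =>
      exfalso
      cases hl : ρ.lhs with
      | var x => exact hR.lhs_ne_var ρ hρ x hl
      | app g ls =>
        rw [hl] at hu
        simp only [Term.subst] at hu
        injection hu with h1
        subst h1
        exact hf ⟨ρ, hρ, ls, hl⟩
    | arg g us i t' h =>
      cases hu
      obtain ⟨m, hm, h'⟩ := iter_app hR hf n _ t ht
      refine ⟨Function.update m i (m i + 1), ?_, fun j => ?_⟩
      · rw [Finset.sum_update_of_mem (Finset.mem_univ i),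
          ← Finset.add_sum_erase _ m (Finset.mem_univ i), Finset.sdiff_singleton_eq_erase] at *
        omega
      · by_cases hj : j = i
        · subst hj
          obtain ⟨t'', h''⟩ := h' j
          rw [Function.update_self] at h'' ⊢
          exact ⟨t'', t', h, h''⟩
        · obtain ⟨t'', h''⟩ := h' j
          rw [Function.update_of_ne hj] at h'' ⊢
          exact ⟨t'', h''⟩

theorem NF.iter_eq_zero {ok : Term S V → Prop} {n : ℕ} {s t : Term S V} (hs : NF R s)
    (h : iter (Step ok R) n s t) : n = 0 := by
  cases n with
  | zero => rfl
  | succ n =>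
    obtain ⟨u, hu, _⟩ := h
    exact absurd hu hs.not_step

theorem subterm_of_mem_cuts {D : Set S.Sym} {u r : Term S V} (h : u ∈ cuts st D r) :
    Subterm u r := by
  induction r with
  | var x =>
    cases st with
    | full =>
      simp only [cuts, List.mem_singleton] at h
      rw [h]; exact .refl _
    | innermost => simp [cuts] at h
  | app f ts ih =>
    unfold cuts at h
    split_ifs at h
    · rw [List.mem_singleton.1 h]; exact .refl _
    · simp only [List.mem_flatten, List.mem_ofFn] at h
      obtain ⟨_, ⟨i, rfl⟩, hu⟩ := h
      exact .arg f ts i (ih i hu)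

/-- A derivation from an instance of `r` splits into derivations from the instances of the
maximal subterms of `r` that are cut out for the dependency pair. -/
theorem sumSplit_cuts (hR : IsTRS R) {σ : V → Term S V} (r : Term S V) :
    (st = .innermost → ∀ x ∈ r.vars, NF R (σ x)) → ∀ (n : ℕ) (t : Term S V),
      iter (Step (st.ok R) R) n (r.subst σ) t →
      SumSplit (fun u m => ∃ t, iter (Step (st.ok R) R) m (u.subst σ) t)
        (cuts st (Defined R) r) n := by
  induction r with
  | var x =>
    intro hσ n t h
    cases st with
    | full => exact .singleton ⟨t, h⟩
    | innermost =>
      rw [NF.iter_eq_zero (hσ rfl x (.refl _)) h]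
      exact .nil
  | app f rs ih =>
    intro hσ n t h
    unfold cuts
    split_ifs with hf
    · exact .singleton ⟨t, h⟩
    · obtain ⟨m, rfl, hm⟩ := iter_app hR hf n _ t h
      refine .flatten _ m fun i => ?_
      obtain ⟨t', ht'⟩ := hm i
      exact ih i (fun hst x hx => hσ hst x (mem_vars_app.2 ⟨i, hx⟩)) _ t' ht'

end Cuts

/-! ### Compound terms as right-hand sides of pairs -/

section Compound

variable {S : Sig.{u}} {V : Type v}

theorem compound_eq_comTerm (ρ : Rule S V) {us : List (Term (S.ext V) V)} (h : us.length ≠ 1) :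
    compound ρ us = comTerm us.length ρ us.get := by
  match us, h with
  | [], _ => rfl
  | _ :: _ :: _, _ => rfl

theorem comTerm_congr (ρ : Rule S V) {m n : ℕ} (h : m = n) {us : Fin m → Term (S.ext V) V}
    {vs : Fin n → Term (S.ext V) V} (huv : ∀ i, us i = vs (i.cast h)) :
    comTerm m ρ us = comTerm n ρ vs := by
  subst h
  congr 1
  funext i
  exact huv i

theorem compound_subst (ρ : Rule S V) (us : List (Term (S.ext V) V))
    (τ : V → Term (S.ext V) V) :
    (compound ρ us).subst τ = compound ρ (us.map (Term.subst τ)) := by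
  by_cases h : us.length = 1
  · obtain ⟨u, rfl⟩ := List.length_eq_one_iff.1 h
    rfl
  · rw [compound_eq_comTerm ρ h, compound_eq_comTerm ρ (by simpa using h)]
    change comTerm us.length ρ (fun i => (us.get i).subst τ) = _
    exact comTerm_congr ρ (by simp) fun i => by simp

theorem subterm_compound (ρ : Rule S V) {us : List (Term (S.ext V) V)} {u : Term (S.ext V) V}
    (hu : u ∈ us) : Subterm u (compound ρ us) := by
  by_cases h : us.length = 1
  · obtain ⟨v, rfl⟩ := List.length_eq_one_iff.1 h
    rw [List.mem_singleton.1 hu]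
    exact .refl _
  · rw [compound_eq_comTerm ρ h]
    obtain ⟨i, rfl⟩ := List.get_of_mem hu
    exact Subterm.arg (S := S.ext V) (ExtSym.com us.length ρ) us.get i (.refl _)

end Compound

/-! ### Simulation of a derivation along all source paths -/

section Simulation

variable {S : Sig.{u}} {V : Type v}

/-- The derivations with the pairs of a path and their usable rules. -/
def PathDeriv (st : Strategy) (R : Set (Rule S V)) (Ps : List (Set (Rule (S.ext V) V)))
    (K : Set (Rule (S.ext V) V)) :
    Term (S.ext V) V → ℕ → ℕ → ℕ → Term (S.ext V) V → Prop :=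
  Deriv st (unionList (Ps ++ [K]) ∪ usableRules R (unionList (Ps ++ [K]))) K
    (unionList (Ps ++ [K])) (usableRules R (unionList (Ps ++ [K])))

/-- A derivation of length `n` is simulated from `s` by derivations for the source paths that
extend `E₀`: their steps by pairs of the last component (at least `a E` for the path `E`) and by
usable rules (at least `b E`) sum up to at least `n`, and the number of all steps by pairs in each
of them is bounded by the sum of the numbers `a E`. -/
def Simulates (st : Strategy) (R : Set (Rule S V)) (F : Finset (List (Set (Rule (S.ext V) V))))
    (E₀ : List (Set (Rule (S.ext V) V))) (s : Term (S.ext V) V) (n : ℕ) : Prop :=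
  ∃ a b : List (Set (Rule (S.ext V) V)) → ℕ, n ≤ ∑ E ∈ F, (a E + b E) ∧
    (∀ E, ¬ E₀ <+: E → a E = 0 ∧ b E = 0) ∧
    ∀ Ps K, IsSourcePath st R (Ps ++ [K]) → E₀ <+: Ps ++ [K] →
      ∃ x y z t, PathDeriv st R Ps K s x y z t ∧ a (Ps ++ [K]) ≤ x ∧ b (Ps ++ [K]) ≤ y ∧
        z ≤ ∑ E ∈ F, a E

variable {st : Strategy} {R : Set (Rule S V)} {F : Finset (List (Set (Rule (S.ext V) V)))}
  {E₀ : List (Set (Rule (S.ext V) V))}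

theorem Simulates.zero (s : Term (S.ext V) V) : Simulates st R F E₀ s 0 :=
  ⟨fun _ => 0, fun _ => 0, by simp, fun _ _ => ⟨rfl, rfl⟩,
    fun _ _ _ _ => ⟨0, 0, 0, s, .refl s, le_rfl, le_rfl, by simp⟩⟩

theorem Simulates.rule (hE₀ : E₀ ∈ F) {s s' : Term (S.ext V) V} {n : ℕ}
    (hs : ∀ E, IsSourcePath st R E → E₀ <+: E →
      Step (st.ok (unionList E ∪ usableRules R (unionList E))) (usableRules R (unionList E)) s s')
    (h : Simulates st R F E₀ s' n) : Simulates st R F E₀ s (n + 1) := by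
  classical
  obtain ⟨a, b, hn, h0, hD⟩ := h
  -- The rule step is charged to the current history `E₀`, although it is executed in the derivation
  -- of every extension of `E₀`.
  refine ⟨a, fun E => b E + if E = E₀ then 1 else 0, ?_, ?_, ?_⟩
  · simp only [← add_assoc]
    rw [Finset.sum_add_distrib, Finset.sum_ite_eq' F E₀, if_pos hE₀]
    omega
  · intro E hE
    have : E ≠ E₀ := fun e => hE (e ▸ List.prefix_rfl)
    simp [h0 E hE, this]
  · intro Ps K hP hE
    obtain ⟨x, y, z, t, hd, hx, hy, hz⟩ := hD Ps K hP hE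
    refine ⟨x, y + 1, z, t, .rule (hs _ hP hE) hd, hx, ?_, hz⟩
    dsimp only
    split_ifs <;> omega

/-- The pair step is charged to the new history `Ps₁ ++ [K₁]`. It is a strict step for that path, an
ordinary pair step for its proper extensions, and omitted for all other paths. As it plays two
roles, `hs` provides it for every set `X` containing `p`. -/
theorem Simulates.pair {Ps₁ : List (Set (Rule (S.ext V) V))} {K₁ : Set (Rule (S.ext V) V)}
    (hE₁ : Ps₁ ++ [K₁] ∈ F) (hE : E₀ <+: Ps₁ ++ [K₁]) {p : Rule (S.ext V) V} (hp : p ∈ K₁)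
    {s s' : Term (S.ext V) V} {n : ℕ}
    (hs : ∀ E, IsSourcePath st R E → Ps₁ ++ [K₁] <+: E → ∀ X, p ∈ X →
      ComStep (st.ok (unionList E ∪ usableRules R (unionList E))) X s s')
    (h : Simulates st R F (Ps₁ ++ [K₁]) s' n) : Simulates st R F E₀ s (n + 1) := by
  classical
  obtain ⟨a, b, hn, h0, hD⟩ := h
  have hsum : ∑ E ∈ F, (a E + if E = Ps₁ ++ [K₁] then 1 else 0) = ∑ E ∈ F, a E + 1 := by
    rw [Finset.sum_add_distrib, Finset.sum_ite_eq' F (Ps₁ ++ [K₁]), if_pos hE₁]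
  refine ⟨fun E => a E + if E = Ps₁ ++ [K₁] then 1 else 0, b, ?_, ?_, ?_⟩
  · rw [Finset.sum_add_distrib, hsum]
    rw [Finset.sum_add_distrib] at hn
    omega
  · intro E hE'
    have h1 : ¬ Ps₁ ++ [K₁] <+: E := fun h => hE' (hE.trans h)
    have h2 : E ≠ Ps₁ ++ [K₁] := fun e => h1 (e ▸ List.prefix_rfl)
    simp [h0 E h1, h2]
  · intro Ps K hP _
    rw [hsum]
    by_cases hE' : Ps₁ ++ [K₁] <+: Ps ++ [K]
    · obtain ⟨x, y, z, t, hd, hx, hy, hz⟩ := hD Ps K hP hE'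
      by_cases heq : Ps ++ [K] = Ps₁ ++ [K₁]
      · have hK : p ∈ K := by
          have := (List.append_inj' heq rfl).2
          rw [List.singleton_inj.1 this]
          exact hp
        refine ⟨x + 1, y, z + 1, t, .strict (hs _ hP hE' K hK) hd, ?_, hy, by omega⟩
        simp only [if_pos heq]
        omega
      · refine ⟨x, y, z + 1, t, .pair (hs _ hP hE' _ (unionList_mono hE' ?_)) hd, ?_, hy,
          by omega⟩
        · exact ⟨K₁, by simp, hp⟩
        · simp only [if_neg heq]
          omega
    -- This path has branched off: nothing is charged to it from here on, so its derivation may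
    -- stop.
    · refine ⟨0, 0, 0, s, .refl s, ?_, ?_, by omega⟩
      · have : Ps ++ [K] ≠ Ps₁ ++ [K₁] := fun e => hE' (e ▸ List.prefix_rfl)
        simp [h0 _ hE', this]
      · simp [h0 _ hE']

/-- Threads below a compound symbol run independently, so charges and derivations are added over the
arguments. -/
theorem Simulates.compound (ρ : Rule S V) (us : List (Term (S.ext V) V)) {n : ℕ}
    (h : SumSplit (Simulates st R F E₀) us n) : Simulates st R F E₀ (compound ρ us) n := by
  obtain ⟨m, hm, h⟩ := h.exists_fun
  by_cases hl : us.length = 1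
  · obtain ⟨u, rfl⟩ := List.length_eq_one_iff.1 hl
    have h0 := h 0
    have : ∑ i, m i = m 0 := Fin.sum_univ_one m
    rw [← hm, this]
    exact h0
  rw [compound_eq_comTerm ρ hl]
  choose a b hn h0 hD using h
  refine ⟨fun E => ∑ i, a i E, fun E => ∑ i, b i E, ?_, ?_, ?_⟩
  · simp only [← Finset.sum_add_distrib]
    rw [Finset.sum_comm, ← hm]
    exact Finset.sum_le_sum fun i _ => hn i
  · intro E hE
    simp [h0 _ E hE]
  · intro Ps K hP hE
    have hD' := fun i => hD i Ps K hP hE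
    choose x y z t hd hx hy hz using hD'
    refine ⟨_, _, _, _, Deriv.com us.length ρ us.get t x y z hd,
      Finset.sum_le_sum fun i _ => hx i, Finset.sum_le_sum fun i _ => hy i, ?_⟩
    rw [Finset.sum_comm]
    exact Finset.sum_le_sum fun i _ => hz i

theorem Step.emb_usable (hR : IsTRS R) {E : List (Set (Rule (S.ext V) V))}
    (hE : IsSourcePath st R E) {s s' : Term S V} (hs : AllUsable R (unionList E) s)
    (h : Step (st.ok R) R s s') :
    Step (st.ok (unionList E ∪ usableRules R (unionList E))) (usableRules R (unionList E))
      (RC.emb s) (RC.emb s') :=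
  h.emb (fun _ => Strategy.ok_emb (pairs_usable_lhs hR hE.unionList_subset)) hs.embRule_mem
    hR.lhs_ne_var

/-- An unmarked term arises from a variable instance. Its steps all use usable rules and leave the
history unchanged. -/
theorem simulates_emb (hR : IsTRS R) (hE₀ : E₀ ∈ F) :
    ∀ (n : ℕ) (s t : Term S V), AllUsable R (unionList E₀) s → iter (Step (st.ok R) R) n s t →
      Simulates st R F E₀ (emb s) n
  | 0, _, _, _, _ => .zero _
  | n + 1, _, t, hs, ⟨s', h, ht⟩ =>
    .rule hE₀ (fun _ hE hpre => h.emb_usable hR hE (hs.mono (unionList_mono hpre)))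
      (simulates_emb hR hE₀ n s' t (hs.step hR h) ht)

/-- The term `s` occurs in a reduct of an instance of the right-hand side of the pair `p`. -/
def OccursAfter (st : Strategy) (R : Set (Rule S V)) (p : Rule (S.ext V) V)
    (s : Term (S.ext V) V) : Prop :=
  ∃ (σ : V → Term S V) (w : Term (S.ext V) V),
    ReflTransGen (st.rew (embRule '' R)) (p.rhs.subst fun x => emb (σ x)) w ∧ Subterm s w

/-- All defined symbols below the root of `t` are reachable from the right-hand sides of `P`. -/
def ArgsUsable (R : Set (Rule S V)) (P : Set (Rule (S.ext V) V)) (t : Term S V) : Prop :=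
  ∀ u, IsArg u t → AllUsable R P u

/-- Steps below a marked root preserve the occurrence in a reduct, so the edge to the next pair is
still available when the root is finally contracted. -/
theorem OccursAfter.step {p : Rule (S.ext V) V} {s s' : Term (S.ext V) V}
    (hs : OccursAfter st R p s)
    (h : Step (st.ok (embRule '' R)) (embRule '' R) s s') : OccursAfter st R p s' := by
  obtain ⟨σ, w, hw, hsw⟩ := hs
  obtain ⟨w', h1, h2⟩ := h.exists_of_subterm hsw
  refine ⟨σ, w', hw.tail ?_, h2⟩
  unfold Strategy.rew
  rw [st.step_eq]
  exact h1

/-- The simulation property of derivations of length `n` from a term that arises from a path. -/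
def SimulatesFrom (st : Strategy) (R : Set (Rule S V))
    (F : Finset (List (Set (Rule (S.ext V) V)))) (n : ℕ) : Prop :=
  ∀ (Ps : List (Set (Rule (S.ext V) V))) (K : Set (Rule (S.ext V) V)) (p : Rule (S.ext V) V)
    (f : S.Sym) (ts : Fin (S.ar f) → Term S V) (t : Term S V),
    IsSourcePath st R (Ps ++ [K]) → p ∈ K → OccursAfter st R p (mark (app f ts)) →
    ArgsUsable R (unionList (Ps ++ [K])) (app f ts) → iter (Step (st.ok R) R) n (app f ts) t →
    Simulates st R F (Ps ++ [K]) (mark (app f ts)) n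

/-- A left-hand side is not a variable, so its variables lie strictly below the root, where
usability is assumed. The root itself becomes a marked symbol and need not be usable. -/
theorem AllUsable.subst_lhs (hR : IsTRS R) {P : Set (Rule (S.ext V) V)} {ρ : Rule S V}
    (hρ : ρ ∈ R) {σ : V → Term S V} (h : ArgsUsable R P (ρ.lhs.subst σ)) {x : V}
    (hx : x ∈ ρ.rhs.vars) : AllUsable R P (σ x) := by
  obtain ⟨u, hu, hxu⟩ := exists_isArg_of_mem_vars (hR.vars_subset ρ hρ hx) (hR.lhs_ne_var ρ hρ)
  intro f hf
  exact h _ (hu.subst σ) f (mem_funs_subst.2 (.inr ⟨x, hxu, hf⟩))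

/-- The pair contracts the marked root. The rest of the derivation is then split among the
components of the compound term, with induction for marked components and `simulates_emb` for
variables. -/
theorem simulates_root (hR : IsTRS R) (hF : ∀ E, IsSourcePath st R E → E ∈ F)
    {Ps₁ : List (Set (Rule (S.ext V) V))} {ρ : Rule S V} (hρ : ρ ∈ R)
    (hP : IsSourcePath st R (Ps₁ ++ [scc st R (weakPair st R ρ)]))
    (hE : E₀ <+: Ps₁ ++ [scc st R (weakPair st R ρ)]) {σ : V → Term S V}
    (hok : ∀ u, IsArg u (ρ.lhs.subst σ) → st.ok R u)
    (hu : ArgsUsable R (unionList (Ps₁ ++ [scc st R (weakPair st R ρ)])) (ρ.lhs.subst σ))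
    {n : ℕ} {t : Term S V} (ht : iter (Step (st.ok R) R) n (ρ.rhs.subst σ) t)
    (ih : ∀ m ≤ n, SimulatesFrom st R F m) :
    Simulates st R F E₀ (mark (ρ.lhs.subst σ)) (n + 1) := by
  have hpm : weakPair st R ρ ∈ weakPairs st R := ⟨ρ, hρ, rfl⟩
  have hlhs := mark_subst (hR.lhs_ne_var ρ hρ) σ
  refine Simulates.pair (hF _ hP) hE (mem_scc_self hpm)
    (s' := (weakPair st R ρ).rhs.subst fun x => emb (σ x)) ?_ ?_
  · intro E hEs _ X hX
    rw [← hlhs]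
    refine ComStep.root (weakPair st R ρ) hX (fun x => emb (σ x)) fun u hu => ?_
    change IsArg u ((mark ρ.lhs).subst _) at hu
    rw [hlhs] at hu
    obtain ⟨a, ha, rfl⟩ := isArg_mark hu
    exact Strategy.ok_emb (pairs_usable_lhs hR hEs.unionList_subset) (hok a ha)
  · have hrhs : (weakPair st R ρ).rhs = compound ρ ((cuts st (Defined R) ρ.rhs).map mark) := rfl
    rw [hrhs, compound_subst, List.map_map]
    refine Simulates.compound ρ _ ((sumSplit_cuts hR ρ.rhs ?_ n t ht).map _ ?_)
    · rintro rfl x hx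
      obtain ⟨u, hu, hxu⟩ :=
        exists_isArg_of_mem_vars (hR.vars_subset ρ hρ hx) (hR.lhs_ne_var ρ hρ)
      exact NF.subterm (hok _ (hu.subst σ)) (Term.Subterm.subst hxu σ)
    · rintro u hu' m hm ⟨t', ht'⟩
      have hsub := subterm_of_mem_cuts hu'
      cases u with
      | var x => exact simulates_emb hR (hF _ hP) m _ t' (AllUsable.subst_lhs hR hρ hu hsub) ht'
      | app g us =>
        have hmem : Subterm (mark (app g us)) (weakPair st R ρ).rhs :=
          subterm_compound ρ (List.mem_map_of_mem hu')
        change Simulates st R F _ ((mark (app g us)).subst fun x => emb (σ x)) m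
        rw [mark_app_subst]
        refine ih m hm _ _ _ g _ t' hP (mem_scc_self hpm) ⟨σ, _, .refl, ?_⟩ ?_ ht'
        · have := hmem.subst fun x => emb (σ x)
          rwa [mark_app_subst] at this
        · rintro a ⟨g', us', i, h1, rfl⟩ f hf hd
          cases h1
          -- A defined symbol below the root of the new marked term comes either from the right-hand
          -- side of the pair, and is usable by definition, or from the substitution, and was usable
          -- before.
          rcases mem_funs_subst.1 hf with hf | ⟨x, hx, hf⟩
          · refine ⟨_, ⟨_, List.mem_append_right _ (List.mem_singleton.2 rfl),
              mem_scc_self hpm⟩, f, ?_, .refl⟩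
            obtain ⟨ws, hws⟩ := mem_funs_emb.2 ⟨f, hf, rfl⟩
            exact ⟨ws, (hws.trans (Subterm.arg (S := S.ext V) (ExtSym.sharp g)
              (fun i => emb (us i)) i (.refl _))).trans hmem⟩
          · exact AllUsable.subst_lhs hR hρ hu
              (Subterm.trans (mem_vars_app.2 ⟨i, hx⟩) hsub) f hf hd

/-- Strong induction on the length: a root step passes the rest to several shorter derivations, and
a step below the root is a usable rule step with the same history. -/
theorem simulatesFrom (hR : IsTRS R) (hF : ∀ E, IsSourcePath st R E → E ∈ F) (n : ℕ) :
    SimulatesFrom st R F n := by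
  induction n using Nat.strong_induction_on with
  | _ n ih =>
  intro Ps K p f ts t hP hp ho hu ht
  cases n with
  | zero => exact .zero _
  | succ n =>
    obtain ⟨s, hs, ht⟩ := ht
    generalize hv : app f ts = v at *
    cases hs with
    | root ρ hρ σ hok =>
      have he : GraphEdge st R p (weakPair st R ρ) := by
        obtain ⟨τ, w, hw, hsub⟩ := ho
        refine ⟨(hP.1 K (by simp)).subset hp, ⟨ρ, hρ, rfl⟩, τ, σ, w, hw, ?_⟩
        change Subterm ((mark ρ.lhs).subst _) w
        rwa [mark_subst (hR.lhs_ne_var ρ hρ)]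
      obtain ⟨Ps₁, hP₁, hpre⟩ := hP.exists_extension hp he
      exact simulates_root hR hF hρ hP₁ hpre hok
        (fun u hu' => (hu u hu').mono (unionList_mono hpre)) ht
        fun m hm => ih m (by omega)
    | arg g us i t' h =>
      cases hv
      have hus : ∀ j, AllUsable R (unionList (Ps ++ [K])) (ts j) :=
        fun j => hu _ ⟨f, ts, j, rfl, rfl⟩
      refine .rule (hF _ hP) (s' := mark (app f (Function.update ts i t'))) ?_
        (ih n (by omega) Ps K p f _ t hP hp (ho.step ?_) ?_ ht)
      · intro E hE hpre
        rw [mark_app_update]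
        exact Step.arg (S := S.ext V) (ExtSym.sharp f) (fun i => emb (ts i)) i _
          (h.emb_usable hR hE ((hus i).mono (unionList_mono hpre)))
      · rw [mark_app_update]
        refine Step.arg (S := S.ext V) (ExtSym.sharp f) (fun i => emb (ts i)) i _
          (h.emb (fun _ => Strategy.ok_emb ?_) (fun ρ hρ _ _ _ _ => ⟨ρ, hρ, rfl⟩) hR.lhs_ne_var)
        rintro _ ⟨ρ, hρ, rfl⟩
        exact .inl ⟨ρ, hρ, rfl⟩
      · rintro a ⟨g, ws, j, h1, rfl⟩
        cases h1
        by_cases hj : j = i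
        · subst hj
          rw [Function.update_self]
          exact (hus j).step hR h
        · rw [Function.update_of_ne hj]
          exact hus j

/-- Derivations from basic terms are simulated by derivations for the source paths. -/
theorem simulates_basic (hR : IsTRS R) (hF : ∀ E, IsSourcePath st R E → E ∈ F)
    {s t : Term S V} (hs : s ∈ basicTerms R) {n : ℕ} (h : iter (st.rew R) n s t) :
    Simulates st R F [] (mark s) n := by
  unfold Strategy.rew at h
  rw [st.step_eq] at h
  obtain ⟨f, hf, ts, rfl, hts⟩ := hs
  cases n with
  | zero => exact .zero _
  | succ n =>
    obtain ⟨s, hs, ht⟩ := h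
    generalize hv : app f ts = v at *
    cases hs with
    | root ρ hρ σ hok =>
      -- The arguments of a basic term are normal forms, so the first step is at the root. Any
      -- source path to the component of its pair can serve as the initial history.
      obtain ⟨Ps, hPs⟩ := exists_isSourcePath (st := st) hR (weakPair st R ρ) ⟨ρ, hρ, rfl⟩
      refine simulates_root hR hF hρ hPs List.nil_prefix hok ?_ ht
        fun m _ => simulatesFrom hR hF m
      rw [← hv]
      rintro a ⟨g, ws, j, h1, rfl⟩ g hg hd
      cases h1
      exact absurd hd (hts j g hg)
    | arg g us i t' h =>
      cases hv
      exact absurd h (NF.of_constructor hR.lhs_ne_var (hts i)).not_step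

end Simulation

/-! ### Linear bound on derivation lengths in the interpretations -/

section HeightBound

variable {S : Sig.{u}} {V : Type v} {st : Strategy} {R : Set (Rule S V)}

theorem exists_mem_of_mem_vars_compound (ρ : Rule S V) {us : List (Term (S.ext V) V)} {x : V}
    (hx : x ∈ (compound ρ us).vars) : ∃ u ∈ us, x ∈ u.vars := by
  by_cases h : us.length = 1
  · obtain ⟨u, rfl⟩ := List.length_eq_one_iff.1 h
    exact ⟨u, by simp, hx⟩
  · rw [compound_eq_comTerm ρ h] at hx
    obtain ⟨i, hi⟩ := (mem_vars_app (S := S.ext V) (f := ExtSym.com us.length ρ)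
      (ts := us.get)).1 hx
    exact ⟨_, List.get_mem us i, hi⟩

theorem pairs_usable_vars (hR : IsTRS R) {Q : Set (Rule (S.ext V) V)}
    (hQ : Q ⊆ weakPairs st R) :
    ∀ p ∈ Q ∪ usableRules R Q, p.rhs.vars ⊆ p.lhs.vars := by
  rintro p (hp | ⟨ρ, ⟨hρ, _⟩, rfl⟩)
  · obtain ⟨ρ, hρ, rfl⟩ := hQ hp
    intro x hx
    obtain ⟨u, hu, hxu⟩ := exists_mem_of_mem_vars_compound ρ hx
    obtain ⟨r, hr, rfl⟩ := List.mem_map.1 hu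
    rw [vars_mark] at hxu
    change x ∈ (mark ρ.lhs).vars
    rw [vars_mark]
    exact hR.vars_subset ρ hρ (Subterm.trans hxu (subterm_of_mem_cuts hr))
  · change (emb ρ.rhs).vars ⊆ (emb ρ.lhs).vars
    rw [vars_emb, vars_emb]
    exact hR.vars_subset ρ hρ

theorem nonReplNF_mark_basic (hR : IsTRS R) {Q : Set (Rule (S.ext V) V)}
    (hQ : Q ⊆ weakPairs st R) (μ : ReplMap (S.ext V)) {s : Term S V} (hs : s ∈ basicTerms R) :
    NonReplNF (Q ∪ usableRules R Q) μ (mark s) := by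
  intro t ht
  obtain ⟨u, hu, htu⟩ := ht.exists_isArg
  obtain ⟨a, ha, rfl⟩ := isArg_mark hu
  refine NF.subterm (NF.emb (pairs_usable_lhs hR hQ) (NF.of_constructor hR.lhs_ne_var ?_)) htu
  obtain ⟨f, _, ts, rfl, hts⟩ := hs
  obtain ⟨g, us, i, h1, rfl⟩ := ha
  cases h1
  exact hts i

/-- The length of a derivation from a basic term is bounded linearly in the interpretations of
that term. -/
theorem exists_height_bound (hR : IsTRS R)
    (A B : List (Set (Rule (S.ext V) V)) → MatInt (S.ext V))
    (hA : ∀ (Ps : List (Set (Rule (S.ext V) V))) (Q : Set (Rule (S.ext V) V)),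
      IsSourcePath st R Ps → Q = unionList Ps →
        IsRMI R (A Ps) ∧
        (A Ps).MuMonotone (usableMap st (Q ∪ usableRules R Q)) ∧
        Adequate (usableMap st (Q ∪ usableRules R Q)) (A Ps) ∧
        (BddAbove ((A Ps).gapSet Q) ∨
          ∃ Δ, (A Ps).IsWeightGap st Q (usableRules R Q) (markedBasic R) Δ) ∧
        (A Ps).Compatible (usableRules R Q))
    (hB : ∀ (Ps : List (Set (Rule (S.ext V) V))) (K Q : Set (Rule (S.ext V) V)),
      IsSourcePath st R (Ps ++ [K]) → Q = unionList (Ps ++ [K]) →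
        IsRMI R (B (Ps ++ [K])) ∧
        IsComplexityPair st (usableMap st (Q ∪ usableRules R Q)) K
          (unionList Ps ∪ usableRules R Q) (B (Ps ++ [K])).Ge (B (Ps ++ [K])).Gt)
    (F : Finset (List (Set (Rule (S.ext V) V)))) (hF : ∀ E, E ∈ F ↔ IsSourcePath st R E) :
    ∃ Δ : List (Set (Rule (S.ext V) V)) → ℕ, ∀ s ∈ basicTerms R, ∀ n t,
      iter (st.rew R) n s t → n ≤ ∑ E ∈ F, ((B E).eval₀ (mark s) 0 + ((A E).eval₀ (mark s) 0 +
        Δ E * ∑ E' ∈ F, (B E').eval₀ (mark s) 0)) := by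
  have hgap : ∀ E, ∃ Δ, IsSourcePath st R E → Δ ∈ upperBounds ((A E).gapSet (unionList E)) ∨
      (A E).IsWeightGap st (unionList E) (usableRules R (unionList E)) (markedBasic R) Δ := by
    intro E
    by_cases hE : IsSourcePath st R E
    · rcases (hA E _ hE rfl).2.2.2.1 with ⟨Δ, h⟩ | ⟨Δ, h⟩
      · exact ⟨Δ, fun _ => .inl h⟩
      · exact ⟨Δ, fun _ => .inr h⟩
    · exact ⟨0, fun h => absurd h hE⟩
  choose Δ hΔ using hgap
  refine ⟨Δ, fun s hs n t h => ?_⟩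
  obtain ⟨a, b, hn, -, hD⟩ := simulates_basic hR (fun E hE => (hF E).2 hE) hs h
  have hab : ∀ E ∈ F, a E ≤ (B E).eval₀ (mark s) 0 ∧
      b E ≤ (A E).eval₀ (mark s) 0 + Δ E * ∑ E' ∈ F, a E' := by
    intro E hE
    rw [hF] at hE
    obtain ⟨Ps, K, rfl⟩ : ∃ Ps K, E = Ps ++ [K] := by
      rcases List.eq_nil_or_concat' E with rfl | h
      · obtain ⟨K, hK, -⟩ := hE.2.1
        simp at hK
      · exact h
    obtain ⟨x, y, z, t', hd, hx, hy, hz⟩ := hD Ps K hE List.nil_prefix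
    have hvars := pairs_usable_vars hR hE.unionList_subset
    have hnf := nonReplNF_mark_basic hR hE.unionList_subset
      (usableMap st (unionList (Ps ++ [K]) ∪ usableRules R (unionList (Ps ++ [K])))) hs
    have hK : K ⊆ unionList (Ps ++ [K]) := fun p hp => ⟨K, by simp, hp⟩
    obtain ⟨-, hcp⟩ := hB Ps K _ hE rfl
    obtain ⟨-, hmon, had, -, hcomp⟩ := hA _ _ hE rfl
    have h1 := hd.strict_le (B := B (Ps ++ [K])) hK rfl hvars hcp.compound_mono hcp.strict
      (by
        rintro p (⟨L, hL, hp⟩ | hp)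
        · rcases List.mem_append.1 hL with hL | hL
          · exact hcp.weak p (.inl ⟨L, hL, hp⟩)
          · rw [List.mem_singleton.1 hL] at hp
            -- The pairs of the last component are oriented strictly, hence also weakly.
            exact fun α => (hcp.strict p hp α).2
        · exact hcp.weak p (.inr hp)) hnf
    have h2 := hd.rule_le hK rfl hvars hmon hcomp had (hΔ _ hE) hnf
      ⟨mark s, ⟨s, hs, rfl⟩, .refl⟩
    have h3 := Nat.mul_le_mul_left (Δ (Ps ++ [K])) hz
    exact ⟨by omega, by omega⟩
  refine hn.trans (Finset.sum_le_sum fun E hE => ?_)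
  have h1 := hab E hE
  have h2 : ∑ E' ∈ F, a E' ≤ ∑ E' ∈ F, (B E').eval₀ (mark s) 0 :=
    Finset.sum_le_sum fun E hE => (hab E hE).1
  have h3 := Nat.mul_le_mul_left (Δ E) h2
  omega

end HeightBound

/-! ### Polynomial growth of restricted interpretations -/

section Polynomials

/-- The values of finitely many functions are bounded by a common monomial. -/
theorem exists_uniform_monomial_bound {ι T : Type*} [Fintype ι] (size : T → ℕ)
    (hsize : ∀ t, 1 ≤ size t) (p : T → Prop) (f : ι → T → ℕ)
    (h : ∀ i, ∃ c e, ∀ t, p t → f i t ≤ c * size t ^ e) :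
    ∃ c e, ∀ i t, p t → f i t ≤ c * size t ^ e := by
  choose c e h using h
  refine ⟨∑ i, c i, ∑ i, e i, fun i t ht => (h i t ht).trans ?_⟩
  exact Nat.mul_le_mul (Finset.single_le_sum (f := c) (fun _ _ => Nat.zero_le _)
    (Finset.mem_univ i)) (Nat.pow_le_pow_right (hsize t)
      (Finset.single_le_sum (f := e) (fun _ _ => Nat.zero_le _) (Finset.mem_univ i)))

end Polynomials

section Degrees

variable {S : Sig.{u}} {V : Type v}

theorem Term.size_arg_lt (f : S.Sym) (ts : Fin (S.ar f) → Term S V) (i : Fin (S.ar f)) :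
    (ts i).size < (app f ts).size := by
  have := Finset.single_le_sum (f := fun i => (ts i).size) (fun _ _ => Nat.zero_le _)
    (Finset.mem_univ i)
  simp only [size]
  omega

theorem Term.ar_lt_size (f : S.Sym) (ts : Fin (S.ar f) → Term S V) :
    S.ar f < (app f ts).size := by
  have : ∑ i : Fin (S.ar f), 1 ≤ ∑ i, (ts i).size := Finset.sum_le_sum fun i _ => size_pos _
  simp only [size]
  simp at this
  omega

/-- The entries of the interpretations of finitely many symbols are bounded. -/
theorem MatInt.exists_entry_bound (A : MatInt S) {G : Set S.Sym} (hG : G.Finite) :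
    ∃ M, ∀ g ∈ G, (∀ i j k, A.mat g i j k ≤ M) ∧ ∀ j, A.vec g j ≤ M := by
  have := hG.to_subtype
  obtain ⟨M₁, h1⟩ := Finite.exists_le fun x : (Σ g : G, Fin (S.ar g)) ×
    (Fin (A.dim + 1) × Fin (A.dim + 1)) => A.mat x.1.1 x.1.2 x.2.1 x.2.2
  obtain ⟨M₂, h2⟩ := Finite.exists_le fun x : G × Fin (A.dim + 1) => A.vec x.1 x.2
  refine ⟨max M₁ M₂, fun g hg => ⟨fun i j k => ?_, fun j => ?_⟩⟩
  · exact (h1 (⟨⟨g, hg⟩, i⟩, (j, k))).trans (le_max_left _ _)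
  · exact (h2 (⟨g, hg⟩, j)).trans (le_max_right _ _)

theorem MatInt.interp_apply (A : MatInt S) (f : S.Sym)
    (vs : Fin (S.ar f) → Fin (A.dim + 1) → ℕ) (j : Fin (A.dim + 1)) :
    A.interp f vs j = ∑ i, ∑ k, A.mat f i j k * vs i k + A.vec f j := by
  simp [MatInt.interp, Matrix.mulVec, dotProduct]

variable {R : Set (Rule S V)}

/-- Constructor terms over finitely many symbols have values of polynomial growth. -/
theorem IsRMI.constructor_bound {A : MatInt (S.ext V)} (hA : IsRMI R A) {G : Set S.Sym}
    (hG : G.Finite) (j : Fin (A.dim + 1)) :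
    ∃ c e, ∀ t : Term S V, (∀ g ∈ t.funs, g ∈ G ∧ g ∉ Defined R) →
      A.eval₀ (emb t) j ≤ c * t.size ^ e := by
  obtain ⟨M, hM⟩ := A.exists_entry_bound (hG.image ExtSym.base)
  -- Downward induction on the component: row `j` of an upper triangular matrix involves only the
  -- components `k ≥ j`.
  induction j using WellFoundedGT.induction with
  | _ j ih =>
  obtain ⟨C, E, hC⟩ := exists_uniform_monomial_bound (ι := Fin (A.dim + 1))
    (fun t : Term S V => t.size) size_pos (fun t => ∀ g ∈ t.funs, g ∈ G ∧ g ∉ Defined R)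
    (fun k t => if j < k then A.eval₀ (emb t) k else 0) (by
      intro k
      by_cases hk : j < k
      · simpa [hk] using ih k hk
      · exact ⟨0, 0, by simp [hk]⟩)
  -- With `s = |t|`, each of at most `s` arguments of a node contributes at most `(A.dim + 1) * M *
  -- C * s ^ E` through higher components, and the constant vector at most `M`. So a node adds at
  -- most `D * s ^ (E + 1)`; component `j` itself has coefficient at most one and merely accumulates
  -- over the nodes, which costs one more factor `s`.
  refine ⟨(A.dim + 1) * (M * C) + M, E + 2, fun t => ?_⟩
  induction t with
  | var x => intro _; simp [emb, MatInt.eval₀, MatInt.eval]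
  | app f ts iht =>
    intro ht
    obtain ⟨hfG, hfD⟩ := ht f (mem_funs_app.2 (.inl rfl))
    have hts : ∀ i, ∀ g ∈ (ts i).funs, g ∈ G ∧ g ∉ Defined R :=
      fun i g hg => ht g (mem_funs_app.2 (.inr ⟨i, hg⟩))
    obtain ⟨hM1, hM2⟩ := hM _ ⟨f, hfG, rfl⟩
    have hlt := size_arg_lt f ts
    have har := ar_lt_size f ts
    have hsz : (app f ts).size = 1 + ∑ i, (ts i).size := rfl
    set s := (app f ts).size with hs
    set D := (A.dim + 1) * (M * C) + M with hD
    have hrow : ∀ i : Fin (S.ar f), ∑ k, A.mat (ExtSym.base f) i j k * A.eval₀ (emb (ts i)) k ≤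
        A.eval₀ (emb (ts i)) j + (A.dim + 1) * (M * C) * s ^ E := by
      intro i
      have hterm : ∀ k, A.mat (ExtSym.base f) i j k * A.eval₀ (emb (ts i)) k ≤
          (if k = j then A.eval₀ (emb (ts i)) j else 0) + M * C * s ^ E := by
        intro k
        rcases lt_trichotomy k j with hk | rfl | hk
        · rw [(hA f hfD i).1 j k hk]; simp
        · rw [if_pos rfl]
          have := Nat.mul_le_mul_right (A.eval₀ (emb (ts i)) k) ((hA f hfD i).2 k)
          omega
        · rw [if_neg hk.ne', zero_add, mul_assoc]
          refine Nat.mul_le_mul (hM1 i j k) ?_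
          have := hC k (ts i) (hts i)
          rw [if_pos hk] at this
          exact this.trans (Nat.mul_le_mul_left _ (Nat.pow_le_pow_left (hlt i).le _))
      refine (Finset.sum_le_sum fun k _ => hterm k).trans ?_
      rw [Finset.sum_add_distrib]
      simp [mul_assoc]
    have heval : A.eval₀ (emb (app f ts)) j =
        ∑ i : Fin (S.ar f), ∑ k, A.mat (ExtSym.base f) i j k * A.eval₀ (emb (ts i)) k +
          A.vec (ExtSym.base f) j := A.interp_apply (ExtSym.base f) _ j
    rw [heval]
    have h1 : ∑ i : Fin (S.ar f), ∑ k, A.mat (ExtSym.base f) i j k * A.eval₀ (emb (ts i)) k ≤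
        ∑ i : Fin (S.ar f), (D * s ^ (E + 1) * (ts i).size + (A.dim + 1) * (M * C) * s ^ E) := by
      refine Finset.sum_le_sum fun i _ => (hrow i).trans (Nat.add_le_add_right ?_ _)
      refine (iht i (hts i)).trans ?_
      rw [pow_succ, ← mul_assoc]
      exact Nat.mul_le_mul_right _ (Nat.mul_le_mul_left _ (Nat.pow_le_pow_left (hlt i).le _))
    rw [Finset.sum_add_distrib, ← Finset.mul_sum, Finset.sum_const, Finset.card_univ,
      Fintype.card_fin, smul_eq_mul] at h1
    have h2 : S.ar f * ((A.dim + 1) * (M * C) * s ^ E) ≤ (A.dim + 1) * (M * C) * s ^ (E + 1) := by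
      rw [pow_succ, ← mul_assoc _ _ s, mul_comm]
      exact Nat.mul_le_mul_left _ har.le
    have h3 : M * 1 ≤ M * s ^ (E + 1) := Nat.mul_le_mul_left _ (Nat.one_le_pow _ _ (by omega))
    have h4 : D * s ^ (E + 2) = D * s ^ (E + 1) * ∑ i, (ts i).size +
        ((A.dim + 1) * (M * C) * s ^ (E + 1) + M * s ^ (E + 1)) := by
      rw [← add_mul, ← hD, pow_succ _ (E + 1), ← mul_assoc, hsz]
      ring
    have h5 := hM2 j
    omega

/-- Basic terms over finitely many symbols have values of polynomial growth. -/
theorem IsRMI.basic_bound {A : MatInt (S.ext V)} (hA : IsRMI R A) {G : Set S.Sym}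
    (hG : G.Finite) : ∃ c e, ∀ t : Term S V, t ∈ basicTerms R ∧ t.funs ⊆ G →
      A.eval₀ (mark t) 0 ≤ c * t.size ^ e := by
  obtain ⟨M, hM⟩ := A.exists_entry_bound (hG.image ExtSym.sharp)
  obtain ⟨C, E, hC⟩ := exists_uniform_monomial_bound (ι := Fin (A.dim + 1))
    (fun t : Term S V => t.size) size_pos (fun t => ∀ g ∈ t.funs, g ∈ G ∧ g ∉ Defined R)
    (fun k t => A.eval₀ (emb t) k) (hA.constructor_bound hG)
  refine ⟨(A.dim + 1) * (M * C) + M, E + 1, ?_⟩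
  rintro _ ⟨⟨f, hf, ts, rfl, hts⟩, hfG⟩
  obtain ⟨hM1, hM2⟩ := hM _ ⟨f, hfG (mem_funs_app.2 (.inl rfl)), rfl⟩
  have hlt := size_arg_lt f ts
  have har := ar_lt_size f ts
  set s := (app f ts).size with hs
  have heval : A.eval₀ (mark (app f ts)) 0 =
      ∑ i : Fin (S.ar f), ∑ k, A.mat (ExtSym.sharp f) i 0 k * A.eval₀ (emb (ts i)) k +
        A.vec (ExtSym.sharp f) 0 := A.interp_apply (ExtSym.sharp f) _ 0
  have h1 : ∑ i : Fin (S.ar f), ∑ k, A.mat (ExtSym.sharp f) i 0 k * A.eval₀ (emb (ts i)) k ≤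
      ∑ i : Fin (S.ar f), ∑ k : Fin (A.dim + 1), M * (C * s ^ E) := by
    refine Finset.sum_le_sum fun i _ => Finset.sum_le_sum fun k _ =>
      Nat.mul_le_mul (hM1 i 0 k) ((hC k (ts i) fun g hg => ?_).trans
        (Nat.mul_le_mul_left _ (Nat.pow_le_pow_left (hlt i).le _)))
    exact ⟨hfG (mem_funs_app.2 (.inr ⟨i, hg⟩)), hts i g hg⟩
  simp only [Finset.sum_const, Finset.card_univ, Fintype.card_fin, smul_eq_mul] at h1
  have h2 : S.ar f * ((A.dim + 1) * (M * (C * s ^ E))) ≤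
      (A.dim + 1) * (M * C) * s ^ (E + 1) := by
    calc _ ≤ s * ((A.dim + 1) * (M * (C * s ^ E))) := Nat.mul_le_mul_right _ har.le
      _ = _ := by ring
  have h3 : M * 1 ≤ M * s ^ (E + 1) := Nat.mul_le_mul_left _ (Nat.one_le_pow _ _ (by omega))
  have h5 := hM2 0
  rw [heval, add_mul]
  omega

end Degrees

/-! ### Reduction to the symbols of the rewrite system -/

section Abstraction

variable {S : Sig.{u}} {V : Type v} {st : Strategy} {R : Set (Rule S V)}

open scoped Classical in
/-- All maximal subterms whose root is a variable or a symbol outside `G` are replaced by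
variables. -/
noncomputable def abstractTerm (G : Set S.Sym) (φ : Term S V → V) : Term S V → Term S V
  | var x => var (φ (var x))
  | app f ts => if f ∈ G then app f fun i => abstractTerm G φ (ts i) else var (φ (app f ts))

/-- All maximal subterms whose root is a variable or a symbol outside `G` satisfy `P`. -/
def AllPieces (G : Set S.Sym) (P : Term S V → Prop) : Term S V → Prop
  | var x => P (var x)
  | app f ts => (f ∈ G ∧ ∀ i, AllPieces G P (ts i)) ∨ (f ∉ G ∧ P (app f ts))

variable {G : Set S.Sym} {φ : Term S V → V} {ψ : V → Term S V}

theorem abstractTerm_app {f : S.Sym} (hf : f ∈ G) (ts : Fin (S.ar f) → Term S V) :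
    abstractTerm G φ (app f ts) = app f fun i => abstractTerm G φ (ts i) := by
  rw [abstractTerm, if_pos hf]

theorem size_abstractTerm_le (t : Term S V) : (abstractTerm G φ t).size ≤ t.size := by
  induction t with
  | var x => exact le_rfl
  | app f ts ih =>
    rw [abstractTerm]
    split_ifs
    · exact Nat.add_le_add_left (Finset.sum_le_sum fun i _ => ih i) 1
    · exact size_pos _

theorem funs_abstractTerm_subset (t : Term S V) : (abstractTerm G φ t).funs ⊆ G ∩ t.funs := by
  induction t with
  | var x => exact fun g hg => absurd hg not_mem_funs_var
  | app f ts ih =>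
    rw [abstractTerm]
    split_ifs with hf
    · intro g hg
      rcases mem_funs_app.1 hg with rfl | ⟨i, hg⟩
      · exact ⟨hf, mem_funs_app.2 (.inl rfl)⟩
      · exact ⟨(ih i hg).1, mem_funs_app.2 (.inr ⟨i, (ih i hg).2⟩)⟩
    · exact fun g hg => absurd hg not_mem_funs_var

theorem abstractTerm_subst (σ : V → Term S V) {t : Term S V} (ht : t.funs ⊆ G) :
    abstractTerm G φ (t.subst σ) = t.subst fun x => abstractTerm G φ (σ x) := by
  induction t with
  | var x => rfl
  | app f ts ih =>
    simp only [Term.subst]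
    rw [abstractTerm_app (ht (mem_funs_app.2 (.inl rfl)))]
    congr 1
    funext i
    exact ih i fun g hg => ht (mem_funs_app.2 (.inr ⟨i, hg⟩))

theorem allPieces_of_subterm {P : Term S V → Prop} {t : Term S V}
    (h : ∀ a, Subterm a t → P a) : AllPieces G P t := by
  induction t with
  | var x => exact h _ (.refl _)
  | app f ts ih =>
    by_cases hf : f ∈ G
    · exact .inl ⟨hf, fun i => ih i fun a ha => h a (.arg f ts i ha)⟩
    · exact .inr ⟨hf, h _ (.refl _)⟩

theorem allPieces_subst {P : Term S V → Prop} (σ : V → Term S V) {t : Term S V}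
    (ht : t.funs ⊆ G) : AllPieces G P (t.subst σ) ↔ ∀ x ∈ t.vars, AllPieces G P (σ x) := by
  induction t with
  | var x => simp [Term.subst, mem_vars_var]
  | app f ts ih =>
    have hf : f ∈ G := ht (mem_funs_app.2 (.inl rfl))
    have ih' := fun i => ih i fun g hg => ht (mem_funs_app.2 (.inr ⟨i, hg⟩))
    simp only [Term.subst, AllPieces, hf, true_and, not_true_eq_false, false_and, or_false,
      ih', mem_vars_app]
    exact ⟨fun h x ⟨i, hi⟩ => h i x hi, fun h i x hi => h x ⟨i, hi⟩⟩

theorem abstractTerm_subst_inverse {t : Term S V}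
    (h : AllPieces G (fun a => NF R a ∧ ψ (φ a) = a) t) : (abstractTerm G φ t).subst ψ = t := by
  induction t with
  | var x => exact h.2
  | app f ts ih =>
    rw [abstractTerm]
    rcases h with ⟨hf, h⟩ | ⟨hf, h⟩
    · rw [if_pos hf]
      simp only [Term.subst, app.injEq, heq_eq_eq, true_and]
      funext i
      exact ih i (h i)
    · rw [if_neg hf]
      exact h.2

theorem Strategy.ok_abstractTerm {t : Term S V}
    (h : AllPieces G (fun a => NF R a ∧ ψ (φ a) = a) t) (ht : st.ok R t) :
    st.ok R (abstractTerm G φ t) := by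
  cases st with
  | full => trivial
  -- The substitution `ψ` undoes the abstraction, and a term with a normal instance is normal.
  | innermost => exact NF.of_subst ψ ((abstractTerm_subst_inverse h).symm ▸ ht)

/-- Rules contain only symbols of `G`, so a redex is matched above the pieces, and equal pieces
become equal variables, which preserves matches of non-linear rules. The pieces are normal forms, so
no step is lost inside them. -/
theorem Step.abstractTerm (hR : IsTRS R) (hG : ∀ ρ ∈ R, ρ.lhs.funs ⊆ G ∧ ρ.rhs.funs ⊆ G)
    {s t : Term S V} (h : Step (st.ok R) R s t)
    (hs : AllPieces G (fun a => NF R a ∧ ψ (φ a) = a) s) :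
    AllPieces G (fun a => NF R a ∧ ψ (φ a) = a) t ∧
      Step (st.ok R) R (RC.abstractTerm G φ s) (RC.abstractTerm G φ t) := by
  induction h with
  | root ρ hρ σ hok =>
    obtain ⟨hl, hr⟩ := hG ρ hρ
    rw [allPieces_subst σ hl] at hs
    refine ⟨(allPieces_subst σ hr).2 fun x hx => hs x (hR.vars_subset ρ hρ hx), ?_⟩
    rw [abstractTerm_subst σ hl, abstractTerm_subst σ hr]
    refine .root ρ hρ _ fun u hu => ?_
    cases hlhs : ρ.lhs with
    | var x => exact absurd hlhs (hR.lhs_ne_var ρ hρ x)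
    | app f ls =>
      rw [hlhs] at hu hl hs hok
      obtain ⟨g, us, i, h1, rfl⟩ := hu
      cases h1
      have hli : (ls i).funs ⊆ G := fun g hg => hl (mem_funs_app.2 (.inr ⟨i, hg⟩))
      change st.ok R ((ls i).subst fun x => RC.abstractTerm G φ (σ x))
      rw [← abstractTerm_subst σ hli]
      refine Strategy.ok_abstractTerm (ψ := ψ) ((allPieces_subst σ hli).2 fun x hx =>
        hs x (mem_vars_app.2 ⟨i, hx⟩)) (hok _ ⟨f, fun i => (ls i).subst σ, i, rfl, rfl⟩)
  | arg f ts i t h ih =>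
    rcases hs with ⟨hf, hs⟩ | ⟨hf, hs⟩
    · obtain ⟨h1, h2⟩ := ih (hs i)
      refine ⟨.inl ⟨hf, fun j => ?_⟩, ?_⟩
      · by_cases hj : j = i
        · subst hj
          rwa [Function.update_self]
        · rw [Function.update_of_ne hj]
          exact hs j
      · rw [abstractTerm_app hf, abstractTerm_app hf, apply_update]
        exact .arg f (fun i => RC.abstractTerm G φ (ts i)) i _ h2
    · exact absurd (Step.arg f ts i t h) hs.1.not_step

theorem iter_abstractTerm (hR : IsTRS R) (hG : ∀ ρ ∈ R, ρ.lhs.funs ⊆ G ∧ ρ.rhs.funs ⊆ G) :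
    ∀ (n : ℕ) (s t : Term S V), AllPieces G (fun a => NF R a ∧ ψ (φ a) = a) s →
      iter (Step (st.ok R) R) n s t →
      iter (Step (st.ok R) R) n (abstractTerm G φ s) (abstractTerm G φ t)
  | 0, _, _, _, h => congrArg _ h
  | n + 1, _, t, hs, ⟨s', h, ht⟩ =>
    ⟨_, (h.abstractTerm hR hG hs).2, iter_abstractTerm hR hG n s' t
      (h.abstractTerm hR hG hs).1 ht⟩

theorem Term.setOf_subterm_finite (s : Term S V) : {a | Subterm a s}.Finite := by
  induction s with
  | var x => exact (Set.finite_singleton (var x)).subset fun a ha => subterm_var ha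
  | app f ts ih =>
    refine ((Set.finite_singleton (app f ts)).union (Set.finite_iUnion ih)).subset ?_
    intro a ha
    rcases subterm_app ha with h | ⟨i, h⟩
    · exact .inl h
    · exact .inr (Set.mem_iUnion.2 ⟨i, h⟩)

/-- Derivations from basic terms can be replaced by derivations of the same length from basic
terms that contain symbols of the rewrite system only. -/
theorem exists_basic_over [Infinite V] (hR : IsTRS R)
    (hG : ∀ ρ ∈ R, ρ.lhs.funs ⊆ G ∧ ρ.rhs.funs ⊆ G) {s t : Term S V} (hs : s ∈ basicTerms R)
    {n : ℕ} (h : iter (st.rew R) n s t) :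
    ∃ s' t', (s' ∈ basicTerms R ∧ s'.funs ⊆ G) ∧ s'.size ≤ s.size ∧ iter (st.rew R) n s' t' := by
  have hst : st.rew R = Step (st.ok R) R := st.step_eq R R
  rw [hst] at h ⊢
  obtain ⟨ι, hι⟩ := Set.countable_iff_exists_injOn.1 s.setOf_subterm_finite.countable
  -- Infinitely many variables allow an injective naming of the finitely many subterms; `ψ` then
  -- recovers each piece from its name.
  let φ : Term S V → V := fun a => Infinite.natEmbedding V (ι a)
  have hφ : Set.InjOn φ {a | Subterm a s} :=
    fun a ha b hb hab => hι ha hb ((Infinite.natEmbedding V).injective hab)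
  have : Nonempty (Term S V) := ⟨s⟩
  let ψ : V → Term S V := Function.invFunOn φ {a | Subterm a s}
  obtain ⟨f, hf, ts, rfl, hts⟩ := hs
  have hfG : f ∈ G := by
    obtain ⟨ρ, hρ, ls, hl⟩ := hf
    exact (hG ρ hρ).1 (hl ▸ mem_funs_app.2 (.inl rfl))
  have hpieces : AllPieces G (fun a => NF R a ∧ ψ (φ a) = a) (app f ts) := by
    refine .inl ⟨hfG, fun i => allPieces_of_subterm fun a ha => ⟨?_, ?_⟩⟩
    · exact (NF.of_constructor hR.lhs_ne_var (hts i)).subterm ha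
    · exact hφ.leftInvOn_invFunOn (Subterm.arg f ts i ha)
  refine ⟨_, _, ⟨⟨f, hf, _, abstractTerm_app hfG ts, fun i g hg => ?_⟩,
    fun g hg => (funs_abstractTerm_subset _ hg).1⟩, size_abstractTerm_le (φ := φ) (G := G) _,
    iter_abstractTerm (ψ := ψ) hR hG n _ t hpieces h⟩
  exact hts i g (funs_abstractTerm_subset _ hg).2

end Abstraction

/-! ### From derivation lengths to the complexity function -/

section Complexity

variable {S : Sig.{u}} {V : Type v} {st : Strategy} {R : Set (Rule S V)}

theorem rc_le {C d : ℕ} (h : ∀ s ∈ basicTerms R, ∀ n t, iter (st.rew R) n s t →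
    n ≤ C * s.size ^ d) (N : ℕ) : rc st R N ≤ ((C * N ^ d : ℕ) : ℕ∞) := by
  refine iSup₂_le fun s hs => iSup₂_le fun n hn => ?_
  obtain ⟨t, ht⟩ := hn
  exact_mod_cast (h s hs.1 n t ht).trans (Nat.mul_le_mul_left _ (Nat.pow_le_pow_left hs.2 _))

theorem PolyBoundedDeg.of_le {g : ℕ → ℕ∞} {C d : ℕ} (h : ∀ N, g N ≤ ((C * N ^ d : ℕ) : ℕ∞)) :
    PolyBoundedDeg g d :=
  ⟨Polynomial.C C * Polynomial.X ^ d, Polynomial.natDegree_C_mul_X_pow_le C d,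
    Eventually.of_forall fun N => by simpa using h N⟩

theorem PolyBoundedDeg.polyBounded {g : ℕ → ℕ∞} {d : ℕ} (h : PolyBoundedDeg g d) :
    PolyBounded g := by
  obtain ⟨p, -, hp⟩ := h
  exact ⟨p, hp⟩

/-- A bound that is linear in finitely many functions of order `n ^ d` is of order `n ^ d`. -/
theorem exists_monomial_bound_of_linear {ι T : Type*} (F : Finset ι) (size : T → ℕ)
    (p : T → Prop) (α β : ι → T → ℕ) (Δ : ι → ℕ) {d : ℕ}
    (hα : ∀ i ∈ F, ∃ c, ∀ t, p t → α i t ≤ c * size t ^ d)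
    (hβ : ∀ i ∈ F, ∃ c, ∀ t, p t → β i t ≤ c * size t ^ d) :
    ∃ C, ∀ t, p t → ∑ i ∈ F, (β i t + (α i t + Δ i * ∑ j ∈ F, β j t)) ≤ C * size t ^ d := by
  choose! a ha using hα
  choose! b hb using hβ
  refine ⟨∑ i ∈ F, (b i + (a i + Δ i * ∑ j ∈ F, b j)), fun t ht => ?_⟩
  rw [Finset.sum_mul]
  refine Finset.sum_le_sum fun i hi => ?_
  have h1 : ∑ j ∈ F, β j t ≤ (∑ j ∈ F, b j) * size t ^ d := by
    rw [Finset.sum_mul]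
    exact Finset.sum_le_sum fun j hj => hb j hj t ht
  have h2 := Nat.mul_le_mul_left (Δ i) h1
  have h3 := ha i hi t ht
  have h4 := hb i hi t ht
  rw [add_mul, add_mul, mul_assoc]
  omega

end Complexity

/-- The function symbols of a rewrite system. -/
def symbolsOf {S : Sig.{u}} {V : Type v} (R : Set (Rule S V)) : Set S.Sym :=
  ⋃ ρ ∈ R, ρ.lhs.funs ∪ ρ.rhs.funs

theorem symbolsOf_finite {S : Sig.{u}} {V : Type v} {R : Set (Rule S V)} (hR : IsTRS R) :
    (symbolsOf R).Finite :=
  hR.finite.biUnion fun ρ _ => ρ.lhs.funs_finite.union ρ.rhs.funs_finite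

end RC

theorem corollaryc {S : Sig.{u}} {V : Type v} [Infinite V] (st : Strategy)
    (R : Set (Rule S V)) (hR : IsTRS R)
    (A B : List (Set (Rule (S.ext V) V)) → MatInt (S.ext V))
    (hA : ∀ (Ps : List (Set (Rule (S.ext V) V))) (Q : Set (Rule (S.ext V) V)),
      IsSourcePath st R Ps → Q = unionList Ps →
        IsRMI R (A Ps) ∧
        (A Ps).MuMonotone (usableMap st (Q ∪ usableRules R Q)) ∧
        Adequate (usableMap st (Q ∪ usableRules R Q)) (A Ps) ∧
        (BddAbove ((A Ps).gapSet Q) ∨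
          ∃ Δ, (A Ps).IsWeightGap st Q (usableRules R Q) (markedBasic R) Δ) ∧
        (A Ps).Compatible (usableRules R Q))
    (hB : ∀ (Ps : List (Set (Rule (S.ext V) V))) (K Q : Set (Rule (S.ext V) V)),
      IsSourcePath st R (Ps ++ [K]) → Q = unionList (Ps ++ [K]) →
        IsRMI R (B (Ps ++ [K])) ∧
        IsComplexityPair st (usableMap st (Q ∪ usableRules R Q)) K
          (unionList Ps ∪ usableRules R Q) (B (Ps ++ [K])).Ge (B (Ps ++ [K])).Gt) :
    PolyBounded (rc st R) ∧
      ∀ d : ℕ,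
        (∀ Ps, IsSourcePath st R Ps →
          HasBasicDegree R (A Ps) d ∧ HasBasicDegree R (B Ps) d) →
        PolyBoundedDeg (rc st R) d := by
  have hfin := setOf_isSourcePath_finite (st := st) hR
  have hF : ∀ E, E ∈ hfin.toFinset ↔ IsSourcePath st R E := fun E => hfin.mem_toFinset
  obtain ⟨Δ, hΔ⟩ := exists_height_bound hR A B hA hB hfin.toFinset hF
  constructor
  -- Over an infinite signature the matrix entries may be unbounded, so polynomial growth is used
  -- only for basic terms over the symbols of `R`.
  · have hG := symbolsOf_finite hR
    have hRMI : ∀ i : Bool × hfin.toFinset,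
        IsRMI R (if i.1 then A i.2.1 else B i.2.1) := by
      rintro ⟨b, E, hE⟩
      rw [hF] at hE
      cases b with
      | true => exact (hA E _ hE rfl).1
      | false =>
        rcases List.eq_nil_or_concat' E with rfl | ⟨Ps, K, rfl⟩
        · obtain ⟨K, hK, -⟩ := hE.2.1
          simp at hK
        · exact (hB Ps K _ hE rfl).1
    obtain ⟨c, e, hc⟩ := exists_uniform_monomial_bound (fun t : Term S V => t.size)
      Term.size_pos (fun t => t ∈ basicTerms R ∧ t.funs ⊆ symbolsOf R)
      (fun (i : Bool × hfin.toFinset) t => (if i.1 then A i.2.1 else B i.2.1).eval₀ (mark t) 0)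
      fun i => (hRMI i).basic_bound hG
    obtain ⟨C, hC⟩ := exists_monomial_bound_of_linear hfin.toFinset (fun t : Term S V => t.size)
      (fun t => t ∈ basicTerms R ∧ t.funs ⊆ symbolsOf R)
      (fun E t => (A E).eval₀ (mark t) 0) (fun E t => (B E).eval₀ (mark t) 0) Δ (d := e)
      (fun E hE => ⟨c, hc (true, ⟨E, hE⟩)⟩) (fun E hE => ⟨c, hc (false, ⟨E, hE⟩)⟩)
    refine (PolyBoundedDeg.of_le (rc_le (C := C) (d := e) fun s hs n t h => ?_)).polyBounded
    obtain ⟨s', t', hs', hsize, h'⟩ := exists_basic_over (G := symbolsOf R) hR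
      (fun ρ hρ => Set.union_subset_iff.1 (Set.subset_biUnion_of_mem
        (u := fun ρ : Rule S V => ρ.lhs.funs ∪ ρ.rhs.funs) hρ)) hs h
    -- The abstracted term has a derivation of the same length and is not larger than the original
    -- one.
    exact ((hΔ s' hs'.1 n t' h').trans (hC s' hs')).trans
      (Nat.mul_le_mul_left _ (Nat.pow_le_pow_left hsize _))
  · intro d hd
    obtain ⟨C, hC⟩ := exists_monomial_bound_of_linear hfin.toFinset (fun t : Term S V => t.size)
      (fun t => t ∈ basicTerms R)
      (fun E t => (A E).eval₀ (mark t) 0) (fun E t => (B E).eval₀ (mark t) 0) Δ (d := d)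
      (fun E hE => (hd E ((hF E).1 hE)).1.imp fun c h t ht => h t ht 0)
      (fun E hE => (hd E ((hF E).1 hE)).2.imp fun c h t ht => h t ht 0)
    exact .of_le (rc_le fun s hs n t h => (hΔ s hs n t h).trans (hC s hs))
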